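/- Let $M$ be a smooth manifold of dimension $2n$ (without boundary, not assumed compact) with a locally conformal symplectic structure: a nondegenerate $2$-form $\omega$ and a $1$-form $\theta$ with $d\omega=-\omega\wedge\theta$ and $d\theta=0$. For $k\in\mathbb Z$ let $d_k\alpha=d\alpha+k\,\theta\wedge\alpha$ on the space $\Omega^*(M)$ of smooth differential forms, and let $H^m_k(M)=\ker(d_k|_{\Omega^m(M)})/d_k(\Omega^{m-1}(M))$. Put $L\alpha=\omega\wedge\alpha$ and filter $K^*=\Omega^*(M)$ by $F^pK^*=L^p\Omega^*(M)$ for $p\ge 0$ and $F^pK^*=\Omega^*(M)$ for $p<0$; then $(F^*K^*,d_k)$ is a filtered complex. Let $\{E^{p,q}_{k,r},\,d_{k,r}\}$ be its spectral sequence: $$E^{p,q}_{k,r}=Z^{p,q}_{k,r}\big/\big(Z^{p+1,q-1}_{k,r-1}+B^{p,q}_{k,r-1}\big),\qquad d_{k,r}\colon E^{p,q}_{k,r}\to E^{p+r,q-r+1}_{k,r},\quad [x]\mapsto[d_kx],$$ where $Z^{p,q}_{k,r}=F^pK^{p+q}\cap d_k^{-1}(F^{p+r}K^{p+q+1})$ and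 $B^{p,q}_{k,r}=F^pK^{p+q}\cap d_k(F^{p-r}K^{p+q-1})$. Assume that $\omega=d_1\tau$ for some $1$-form $\tau$ on $M$. Then for every $l\in\mathbb Z$: 1. $E^{p,q}_{l,2}=0$ if $1\le p\le q\le n-1$. 2. If $0\le q\le n$, then $E^{0,q}_{l,2}\cong H^q_l(M)$. 3. If $0\le p\le n$, then $E^{p,n}_{l+p,2}\cong H^{n+p}_{l+p}(M)$. 4. The spectral sequence $\{E^{p,q}_{l,r},d_{l,r}\}$ stabilizes at the term $E_{l,2}$: for all $r\ge 2$ the differentials $d_{l,r}$ vanish, and $[x]\mapsto[x]$ is an isomorphism $E^{p,q}_{l,r+1}\to E^{p,q}_{l,r}$ for all $p,q$. The isomorphisms in 2 and 3 are the canonical ones, sending the cohomology class of a closed form to its class in the $E_2$-term. -/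

import Mathlib

set_option maxSynthPendingDepth 3
open scoped Manifold Topology

namespace LCS

/-- Alternating `k`-forms on the real normed space `E`, i.e. elements of `Λ^k E*`. -/
abbrev Alt (E : Type*) [NormedAddCommGroup E] [NormedSpace ℝ E] (k : ℕ) : Type _ :=
  E [⋀^Fin k]→L[ℝ] ℝ

section Linear
variable {E : Type*} [NormedAddCommGroup E] [NormedSpace ℝ E]

/-- For a linear map `c : E → Λ^k E*` (a tensor `∑ ξ_j ⊗ β_j`), the `(k + 1)`-form `∑ ξ_j ∧ β_j`, that is
`(v₀, …, v_k) ↦ ∑ i, (-1)^i c(v_i)(v₀, …, v̂_i, …, v_k)`; see `antisym_apply`. -/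
noncomputable def antisym (E : Type*) [NormedAddCommGroup E] [NormedSpace ℝ E] (k : ℕ) :
    (E →L[ℝ] Alt E k) →L[ℝ] Alt E (k + 1) :=
  ContinuousAlternatingMap.alternatizeUncurryFinCLM ℝ E ℝ

/-- Interior product `a ↦ (x ↦ ι_x a)`, where `ι_x a = a(x, ·, …, ·)`. -/
noncomputable def contract (E : Type*) [NormedAddCommGroup E] [NormedSpace ℝ E] (k : ℕ) :
    Alt E (k + 1) →L[ℝ] E →L[ℝ] Alt E k :=
  (ContinuousAlternatingMap.curryLeftLI (𝕜 := ℝ) (E := E) (F := ℝ)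
    (n := k)).toContinuousLinearMap

/-- The wedge product `Λ^k × Λ^l → Λ^(l + k)`, as a continuous bilinear map, with the usual
normalization `(ξ ∧ η)(v, w) = ξ(v) η(w) - ξ(w) η(v)` for `1`-forms. It is defined by recursion on `k`:
for a function `a` it is scalar multiplication, and for a `(k + 1)`-form `a`
`a ∧ b = (k + 1)⁻¹ ∑ i, e^i ∧ (ι_{e_i} a ∧ b)` in a basis `e_i` with dual basis `e^i`; written without
a basis this is `wedge_succ`. The properties `wedge_zero`, `wedge_succ` for `k = 0` and
`wedge_one_wedge` below, that is `(ξ ∧ b) ∧ c = ξ ∧ (b ∧ c)`, characterize it. -/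
noncomputable def wedge (E : Type*) [NormedAddCommGroup E] [NormedSpace ℝ E] :
    (k l : ℕ) → Alt E k →L[ℝ] Alt E l →L[ℝ] Alt E (l + k)
  | 0, _ => (ContinuousLinearMap.lsmul ℝ ℝ).comp
      (ContinuousAlternatingMap.constOfIsEmptyLIE ℝ E ℝ (Fin 0)).symm.toContinuousLinearEquiv.toContinuousLinearMap
  | k + 1, l => ((k : ℝ) + 1)⁻¹ • ContinuousLinearMap.flip
      ((((ContinuousLinearMap.compL ℝ _ _ _).flip (contract E k)).comp
        (ContinuousLinearMap.compL ℝ _ _ _ (antisym E (l + k)))).comp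
          ((ContinuousLinearMap.compL ℝ E _ _).comp (wedge E k l).flip))

theorem antisym_apply {k : ℕ} (c : E →L[ℝ] Alt E k) (v : Fin (k + 1) → E) :
    antisym E k c v = ∑ i : Fin (k + 1), (-1) ^ (i : ℕ) • c (v i) (i.removeNth v) :=
  ContinuousAlternatingMap.alternatizeUncurryFin_apply c v

theorem contract_apply {k : ℕ} (a : Alt E (k + 1)) (x : E) (v : Fin k → E) :
    contract E k a x v = a (Matrix.vecCons x v) := rfl

theorem wedge_zero {l : ℕ} (a : Alt E 0) (b : Alt E l) : wedge E 0 l a b = a ![] • b := by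
  simp [wedge]

theorem wedge_succ {k l : ℕ} (a : Alt E (k + 1)) (b : Alt E l) :
    wedge E (k + 1) l a b =
      ((k : ℝ) + 1)⁻¹ • antisym E (l + k) (((wedge E k l).flip b).comp (contract E k a)) := rfl

theorem antisym_flip {k : ℕ} (f : E →L[ℝ] E →L[ℝ] Alt E k) :
    antisym E (k + 1) ((antisym E k).comp f.flip) =
      - antisym E (k + 1) ((antisym E k).comp f) := by
  have h := ContinuousAlternatingMap.alternatizeUncurryFin_alternatizeUncurryFinCLM_comp_of_symmetric
    (f := f.flip + f) (by intro x y; simp [add_comm])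
  rw [eq_neg_iff_add_eq_zero, ← map_add, ← ContinuousLinearMap.comp_add]
  exact h

theorem antisym_comp {F : Type*} [NormedAddCommGroup F] [NormedSpace ℝ F] {k : ℕ}
    (c : E →L[ℝ] Alt E k) (g : F →L[ℝ] E) :
    (antisym E k c).compContinuousLinearMap g =
      antisym F k (((ContinuousAlternatingMap.compContinuousLinearMapCLM g).comp c).comp g) := by
  ext v
  simp [antisym_apply, Function.comp_def]
  rfl

theorem wedge_comp {F : Type*} [NormedAddCommGroup F] [NormedSpace ℝ F] {k l : ℕ}
    (a : Alt E k) (b : Alt E l) (g : F →L[ℝ] E) :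
    (wedge E k l a b).compContinuousLinearMap g =
      wedge F k l (a.compContinuousLinearMap g) (b.compContinuousLinearMap g) := by
  induction k with
  | zero =>
    rw [wedge_zero, wedge_zero]
    ext v
    simp [Matrix.empty_eq]
  | succ k ih =>
    rw [wedge_succ, wedge_succ]
    change ((k : ℝ) + 1)⁻¹ • ((antisym E (l + k) _).compContinuousLinearMap g) = _
    rw [antisym_comp]
    congr 2
    ext1 x
    simp only [ContinuousLinearMap.comp_apply, ContinuousLinearMap.flip_apply]
    refine (ih _).trans ?_
    congr 2
    ext v
    simp [contract_apply, Function.comp_def]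
    congr 1; ext i; cases i using Fin.cases <;> simp

theorem contract_antisym_zero (c : E →L[ℝ] Alt E 0) (x : E) :
    contract E 0 (antisym E 0 c) x = c x := by
  ext v
  simp only [contract_apply, antisym_apply]
  simp

theorem contract_antisym {k : ℕ} (c : E →L[ℝ] Alt E (k + 1)) (x : E) :
    contract E (k + 1) (antisym E (k + 1) c) x =
      c x - antisym E k (((contract E k).comp c).flip x) := by
  ext v
  rw [contract_apply, antisym_apply, Fin.sum_univ_succ]
  change _ = c x v - antisym E k _ v
  rw [antisym_apply, sub_eq_add_neg, ← Finset.sum_neg_distrib]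
  congr 1
  · simp
  · refine Finset.sum_congr rfl fun i _ => ?_
    have : (i.succ).removeNth (Matrix.vecCons x v) = Matrix.vecCons x (i.removeNth v) := by
      ext j
      cases j using Fin.cases <;> simp [Fin.removeNth]
    rw [this]
    simp [pow_succ, contract_apply]

/-- `∑ (c_j ∧ b)` antisymmetrized over an extra slot is `(antisym c) ∧ b`. -/
theorem antisym_wedge_left {k l : ℕ} (c : E →L[ℝ] Alt E k) (b : Alt E l) :
    antisym E (l + k) (((wedge E k l).flip b).comp c) =
      wedge E (k + 1) l (antisym E k c) b := by
  induction k with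
  | zero =>
    rw [wedge_succ]
    simp only [Nat.cast_zero, zero_add, inv_one, one_smul]
    congr 2
    ext1 x
    exact (contract_antisym_zero c x).symm
  | succ k ih =>
    rw [wedge_succ]
    have h1 : (contract E (k + 1)) (antisym E (k + 1) c) =
        c - (antisym E k).comp ((contract E k).comp c).flip := by
      ext1 x
      exact contract_antisym c x
    have h2 : ((wedge E (k + 1) l).flip b).comp
        ((antisym E k).comp ((contract E k).comp c).flip) =
        (antisym E (l + k)).comp
        (((((ContinuousLinearMap.compL ℝ _ _ _) ((wedge E k l).flip b)).comp (contract E k)).comp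
          c).flip) := by
      ext1 x
      refine (ih (((contract E k).comp c).flip x)).symm.trans ?_
      rfl
    have h3 : (antisym E (l + k)).comp
        (((((ContinuousLinearMap.compL ℝ _ _ _) ((wedge E k l).flip b)).comp (contract E k)).comp
          c)) = ((k : ℝ) + 1) • (((wedge E (k + 1) l).flip b).comp c) := by
      ext1 x
      change antisym E (l + k) (((wedge E k l).flip b).comp (contract E k (c x))) =
        ((k : ℝ) + 1) • wedge E (k + 1) l (c x) b
      rw [wedge_succ, smul_smul, mul_inv_cancel₀ (by positivity), one_smul]
    have h4 := antisym_flip (((((ContinuousLinearMap.compL ℝ _ _ _)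
      ((wedge E k l).flip b)).comp (contract E k)).comp c))
    have h5 : antisym E (l + (k + 1)) ((antisym E (l + k)).comp
        (((((ContinuousLinearMap.compL ℝ _ _ _) ((wedge E k l).flip b)).comp (contract E k)).comp
          c).flip)) =
        -(((k : ℝ) + 1) • antisym E (l + (k + 1)) (((wedge E (k + 1) l).flip b).comp c)) := by
      rw [← map_smul, ← h3]
      exact h4
    rw [h1, ContinuousLinearMap.comp_sub, map_sub, h2, h5, sub_neg_eq_add]
    have : (((k : ℝ) + 1) + 1) ≠ 0 := by positivity
    rw [eq_inv_smul_iff₀ (by push_cast; exact this), Nat.cast_succ, add_smul _ (1 : ℝ), one_smul]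
    exact add_comm _ _

theorem antisym_wedge_one {l : ℕ} (a : Alt E 1) (c : E →L[ℝ] Alt E l) :
    antisym E (l + 1) ((wedge E 1 l a).comp c) = - wedge E 1 (l + 1) a (antisym E l c) := by
  have h := antisym_flip ((((ContinuousLinearMap.compL ℝ _ _ _).flip (contract E 0 a)).comp
    (wedge E 0 l).flip).comp c)
  have e1 : (antisym E l).comp ((((ContinuousLinearMap.compL ℝ _ _ _).flip (contract E 0 a)).comp
    (wedge E 0 l).flip).comp c) = (wedge E 1 l a).comp c := by
    ext1 x
    simp [wedge_succ]
  have e2 : (antisym E l).comp ((((ContinuousLinearMap.compL ℝ _ _ _).flip (contract E 0 a)).comp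
    (wedge E 0 l).flip).comp c).flip =
      ((wedge E 0 (l + 1)).flip (antisym E l c)).comp (contract E 0 a) := by
    ext1 x
    change antisym E l ((wedge E 0 l (contract E 0 a x)).comp c) =
      wedge E 0 (l + 1) (contract E 0 a x) (antisym E l c)
    rw [wedge_zero, ← map_smul]
    congr 1
    ext1 y
    exact wedge_zero _ _
  have h' : antisym E (l + 1) (((wedge E 0 (l + 1)).flip (antisym E l c)).comp (contract E 0 a)) =
      - antisym E (l + 1) ((wedge E 1 l a).comp c) := by
    rw [← e1, ← e2]
    exact h
  rw [wedge_succ]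
  simp only [Nat.cast_zero, zero_add, inv_one, one_smul]
  exact (neg_eq_iff_eq_neg.mpr h').symm

theorem antisym_wedge_two {l : ℕ} (a : Alt E 2) (c : E →L[ℝ] Alt E l) :
    antisym E (l + 2) ((wedge E 2 l a).comp c) = wedge E 2 (l + 1) a (antisym E l c) := by
  have h := antisym_flip ((((ContinuousLinearMap.compL ℝ _ _ _).flip (contract E 1 a)).comp
    (wedge E 1 l).flip).comp c)
  have e1 : (antisym E (l + 1)).comp ((((ContinuousLinearMap.compL ℝ _ _ _).flip
    (contract E 1 a)).comp (wedge E 1 l).flip).comp c) = (2 : ℝ) • (wedge E 2 l a).comp c := by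
    ext1 x
    change _ = (2 : ℝ) • wedge E 2 l a (c x)
    rw [wedge_succ, smul_smul]
    norm_num
  have e2 : (antisym E (l + 1)).comp ((((ContinuousLinearMap.compL ℝ _ _ _).flip
    (contract E 1 a)).comp (wedge E 1 l).flip).comp c).flip =
      - ((wedge E 1 (l + 1)).flip (antisym E l c)).comp (contract E 1 a) := by
    ext1 x
    exact antisym_wedge_one (contract E 1 a x) c
  rw [e1, e2, map_neg, neg_inj, map_smul] at h
  rw [wedge_succ]
  refine Eq.trans ?_ (congrArg (fun t => (((1 : ℕ) : ℝ) + 1)⁻¹ • t) h.symm)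
  rw [smul_smul]
  norm_num

theorem wedge_one_self {l : ℕ} (a : Alt E 1) (b : Alt E l) :
    wedge E 1 (l + 1) a (wedge E 1 l a b) = 0 := by
  have h : antisym E (l + 1) ((wedge E 1 l a).comp
      (((wedge E 0 l).flip b).comp (contract E 0 a))) =
      - wedge E 1 (l + 1) a (antisym E l (((wedge E 0 l).flip b).comp (contract E 0 a))) :=
    antisym_wedge_one a (((wedge E 0 l).flip b).comp (contract E 0 a))
  have h1 : wedge E 1 l a b = antisym E l (((wedge E 0 l).flip b).comp (contract E 0 a)) := by
    rw [wedge_succ]; simp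
  have h2 : (wedge E 1 l a).comp (((wedge E 0 l).flip b).comp (contract E 0 a)) =
      ((wedge E 0 (l + 1)).flip (wedge E 1 l a b)).comp (contract E 0 a) := by
    ext1 x
    change wedge E 1 l a (wedge E 0 l (contract E 0 a x) b) =
      wedge E 0 (l + 1) (contract E 0 a x) (wedge E 1 l a b)
    rw [wedge_zero, wedge_zero, map_smul]
  have h3 : wedge E 1 (l + 1) a (wedge E 1 l a b) =
      antisym E (l + 1) (((wedge E 0 (l + 1)).flip (wedge E 1 l a b)).comp (contract E 0 a)) := by
    rw [wedge_succ]; simp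
  rw [h2] at h
  have h4 : wedge E 1 (l + 1) a (wedge E 1 l a b) = - wedge E 1 (l + 1) a (wedge E 1 l a b) := by
    conv_rhs => rw [h1]
    exact h3.trans h
  have h5 := add_eq_zero_iff_eq_neg.mpr h4
  rw [← two_smul ℝ] at h5
  exact (smul_eq_zero.mp h5).resolve_left two_ne_zero

/-- Associativity of the wedge product for a `1`-form in the first slot. -/
theorem wedge_one_wedge {k l : ℕ} (a : Alt E 1) (b : Alt E k) (c : Alt E l) :
    wedge E (k + 1) l (wedge E 1 k a b) c = wedge E 1 (l + k) a (wedge E k l b c) := by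
  have h1 : wedge E 1 k a b = antisym E k (((wedge E 0 k).flip b).comp (contract E 0 a)) := by
    rw [wedge_succ]; simp
  have h2 : wedge E 1 (l + k) a (wedge E k l b c) =
      antisym E (l + k) (((wedge E 0 (l + k)).flip (wedge E k l b c)).comp (contract E 0 a)) := by
    rw [wedge_succ]; simp
  rw [h1, h2, ← antisym_wedge_left]
  congr 1
  ext1 x
  change wedge E k l (wedge E 0 k (contract E 0 a x) b) c =
    wedge E 0 (l + k) (contract E 0 a x) (wedge E k l b c)
  rw [wedge_zero, wedge_zero]
  simp

theorem wedge_two_one {l : ℕ} (w : Alt E 2) (a : Alt E 1) (b : Alt E l) :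
    wedge E 2 (l + 1) w (wedge E 1 l a b) = wedge E 1 (l + 2) a (wedge E 2 l w b) := by
  have h1 : wedge E 1 l a b = antisym E l (((wedge E 0 l).flip b).comp (contract E 0 a)) := by
    rw [wedge_succ]; simp
  have h2 : wedge E 1 (l + 2) a (wedge E 2 l w b) =
      antisym E (l + 2) (((wedge E 0 (l + 2)).flip (wedge E 2 l w b)).comp (contract E 0 a)) := by
    rw [wedge_succ]; simp
  rw [h1, h2, ← antisym_wedge_two]
  congr 1
  ext1 x
  change wedge E 2 l w (wedge E 0 l (contract E 0 a x) b) =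
    wedge E 0 (l + 2) (contract E 0 a x) (wedge E 2 l w b)
  rw [wedge_zero, wedge_zero, map_smul]

end Linear
section Chart
variable {E : Type*} [NormedAddCommGroup E] [NormedSpace ℝ E]

theorem extDeriv_eq {k : ℕ} (a : E → Alt E k) (y : E) :
    extDeriv a y = antisym E k (fderiv ℝ a y) := rfl

theorem fderiv_wedge {k l : ℕ} {a : E → Alt E k} {b : E → Alt E l} {y : E}
    (ha : DifferentiableAt ℝ a y) (hb : DifferentiableAt ℝ b y) :
    fderiv ℝ (fun z => wedge E k l (a z) (b z)) y =
      ((wedge E k l).flip (b y)).comp (fderiv ℝ a y) +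
        (wedge E k l (a y)).comp (fderiv ℝ b y) := by
  have h := ((wedge E k l).hasFDerivAt.comp y ha.hasFDerivAt).clm_apply hb.hasFDerivAt
  have := h.fderiv
  simp only [Function.comp_apply] at this
  refine this.trans ?_
  exact add_comm _ _

theorem extDeriv_wedge_one {l : ℕ} {a : E → Alt E 1} {b : E → Alt E l} {y : E}
    (ha : DifferentiableAt ℝ a y) (hb : DifferentiableAt ℝ b y) :
    extDeriv (fun z => wedge E 1 l (a z) (b z)) y =
      wedge E 2 l (extDeriv a y) (b y) - wedge E 1 (l + 1) (a y) (extDeriv b y) := by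
  rw [extDeriv_eq, fderiv_wedge ha hb, map_add, antisym_wedge_one, antisym_wedge_left,
    sub_eq_add_neg]
  rfl

theorem extDeriv_wedge_two {l : ℕ} {a : E → Alt E 2} {b : E → Alt E l} {y : E}
    (ha : DifferentiableAt ℝ a y) (hb : DifferentiableAt ℝ b y) :
    extDeriv (fun z => wedge E 2 l (a z) (b z)) y =
      wedge E 3 l (extDeriv a y) (b y) + wedge E 2 (l + 1) (a y) (extDeriv b y) := by
  rw [extDeriv_eq, fderiv_wedge ha hb, map_add, antisym_wedge_two, antisym_wedge_left]
  rfl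
end Chart

theorem two_le_top : (2 : WithTop ℕ∞) ≤ ((⊤ : ℕ∞) : WithTop ℕ∞) :=
  WithTop.coe_le_coe.mpr (le_top : (2 : ℕ∞) ≤ ⊤)

section Manifold
variable {E : Type*} [NormedAddCommGroup E] [NormedSpace ℝ E]
  {M : Type*} [TopologicalSpace M] [ChartedSpace E M]

/-- The expression of a field of alternating forms `α` in the chart at `x₀`: the pullback of `α`
under the inverse chart. -/
noncomputable def chartRep {k : ℕ} (α : ∀ x : M, TangentSpace 𝓘(ℝ, E) x [⋀^Fin k]→L[ℝ] ℝ) (x₀ : M)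
    (y : E) : Alt E k :=
  (α ((chartAt E x₀).symm y)).compContinuousLinearMap
    (mfderiv 𝓘(ℝ, E) 𝓘(ℝ, E) (chartAt E x₀).symm y)

variable (E M) in
/-- The space `Ω^k(M)` of smooth differential `k`-forms: the sections `x ↦ α x ∈ Λ^k T*_x M` that are
smooth in the charts. -/
def smoothForms (k : ℕ) :
    Submodule ℝ (∀ x : M, TangentSpace 𝓘(ℝ, E) x [⋀^Fin k]→L[ℝ] ℝ) where
  carrier := {α | ∀ x₀ : M, ContDiffOn ℝ (⊤ : ℕ∞) (chartRep α x₀) (chartAt E x₀).target}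
  add_mem' ha hb x₀ := (ha x₀).add (hb x₀)
  zero_mem' _ := contDiffOn_const (c := (0 : Alt E k))
  smul_mem' c _ ha x₀ := (ha x₀).const_smul c

variable (E M) in
/-- Smooth differential `k`-forms on the manifold `M` modelled on `E`. -/
abbrev Form (k : ℕ) : Type _ := smoothForms E M k

/-- The exterior derivative of a form, computed at `x` in the chart at `x`. By `chartRep_extDerivFun`
below, for smooth forms it is given in every chart by the exterior derivative on `E`. -/
noncomputable def extDerivFun {k : ℕ} (α : ∀ x : M, TangentSpace 𝓘(ℝ, E) x [⋀^Fin k]→L[ℝ] ℝ) :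
    ∀ x : M, TangentSpace 𝓘(ℝ, E) x [⋀^Fin (k + 1)]→L[ℝ] ℝ := fun x =>
  (extDeriv (chartRep α x) (chartAt E x x)).compContinuousLinearMap
    (mfderiv 𝓘(ℝ, E) 𝓘(ℝ, E) (chartAt E x) x)

theorem ext_chartRep [IsManifold 𝓘(ℝ, E) (⊤ : ℕ∞) M] {k : ℕ}
    {α β : ∀ x : M, TangentSpace 𝓘(ℝ, E) x [⋀^Fin k]→L[ℝ] ℝ}
    (h : ∀ x : M, chartRep α x (chartAt E x x) = chartRep β x (chartAt E x x)) : α = β := by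
  have key : ∀ (γ : ∀ x : M, TangentSpace 𝓘(ℝ, E) x [⋀^Fin k]→L[ℝ] ℝ) (x : M),
      γ x = (chartRep γ x (chartAt E x x)).compContinuousLinearMap
        (mfderiv 𝓘(ℝ, E) 𝓘(ℝ, E) (chartAt E x) x) := by
    intro γ x
    have hx := mem_chart_source E x
    have h1 := ((mdifferentiable_chart (I := 𝓘(ℝ, E)) (M := M) x).symm_comp_deriv hx)
    have h2 : ∀ z : M, z = x → ∀ A : E →L[ℝ] E, A = ContinuousLinearMap.id ℝ E →
      (γ x : Alt E k) = (γ z : Alt E k).compContinuousLinearMap A := by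
      rintro z rfl A rfl
      rfl
    exact h2 _ ((chartAt E x).left_inv hx) _ h1
  funext x
  rw [key α, key β, h]

theorem chartRep_change [IsManifold 𝓘(ℝ, E) (⊤ : ℕ∞) M] {k : ℕ}
    (α : ∀ x : M, TangentSpace 𝓘(ℝ, E) x [⋀^Fin k]→L[ℝ] ℝ) {x₀ x₁ : M} {y : E}
    (hy : y ∈ (chartAt E x₀).target) (hy' : (chartAt E x₀).symm y ∈ (chartAt E x₁).source) :
    chartRep α x₀ y = (chartRep α x₁ (chartAt E x₁ ((chartAt E x₀).symm y))).compContinuousLinearMap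
      (fderiv ℝ (fun z => chartAt E x₁ ((chartAt E x₀).symm z)) y) := by
  have h0 := (mdifferentiable_chart (I := 𝓘(ℝ, E)) (M := M) x₀).mdifferentiableAt_symm hy
  have h1 := (mdifferentiable_chart (I := 𝓘(ℝ, E)) (M := M) x₁).mdifferentiableAt hy'
  have h2 := (mdifferentiable_chart (I := 𝓘(ℝ, E)) (M := M) x₁).symm_comp_deriv hy'
  have h3 : fderiv ℝ (fun z => chartAt E x₁ ((chartAt E x₀).symm z)) y =
      (mfderiv 𝓘(ℝ, E) 𝓘(ℝ, E) (chartAt E x₁) ((chartAt E x₀).symm y)).comp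
        (mfderiv 𝓘(ℝ, E) 𝓘(ℝ, E) (chartAt E x₀).symm y) := by
    rw [← mfderiv_eq_fderiv]
    exact mfderiv_comp y h1 h0
  have key : ∀ (a : M → Alt E k) (w z : M), z = w → ∀ A B C : E →L[ℝ] E,
      A.comp B = ContinuousLinearMap.id ℝ E → (a w).compContinuousLinearMap C =
      ((a z).compContinuousLinearMap A).compContinuousLinearMap (B.comp C) := by
    rintro a w z rfl A B C h
    ext v
    have : ∀ u, A (B u) = u := fun u => congrArg (fun T : E →L[ℝ] E => T u) h
    simp [Function.comp_def, this]
  rw [h3]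
  exact key α _ _ ((chartAt E x₁).left_inv hy') _ _ _ h2

theorem contDiffAt_change [IsManifold 𝓘(ℝ, E) (⊤ : ℕ∞) M] {x₀ x₁ : M} {y : E}
    (hy : y ∈ (chartAt E x₀).target) (hy' : (chartAt E x₀).symm y ∈ (chartAt E x₁).source) :
    ContDiffAt ℝ (⊤ : ℕ∞) (fun z => chartAt E x₁ ((chartAt E x₀).symm z)) y := by
  have h0 : ContMDiffAt 𝓘(ℝ, E) 𝓘(ℝ, E) (⊤ : ℕ∞) (chartAt E x₀).symm y :=
    (contMDiffOn_chart_symm (I := 𝓘(ℝ, E)) (n := (⊤ : ℕ∞)) (x := x₀)).contMDiffAt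
      ((chartAt E x₀).open_target.mem_nhds hy)
  have h1 : ContMDiffAt 𝓘(ℝ, E) 𝓘(ℝ, E) (⊤ : ℕ∞) (chartAt E x₁) ((chartAt E x₀).symm y) :=
    (contMDiffOn_chart (I := 𝓘(ℝ, E)) (n := (⊤ : ℕ∞)) (x := x₁)).contMDiffAt
      ((chartAt E x₁).open_source.mem_nhds hy')
  exact (h1.comp y h0).contDiffAt

theorem chartRep_extDerivFun [IsManifold 𝓘(ℝ, E) (⊤ : ℕ∞) M] {k : ℕ} (α : Form E M k) {x₀ : M} {y : E}
    (hy : y ∈ (chartAt E x₀).target) :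
    chartRep (extDerivFun α.1) x₀ y = extDeriv (chartRep α.1 x₀) y := by
  set x := (chartAt E x₀).symm y with hx
  have hxs : (chartAt E x₀).symm y ∈ (chartAt E x).source := mem_chart_source E x
  have hT := contDiffAt_change hy hxs
  have hev : chartRep α.1 x₀ =ᶠ[𝓝 y] fun z =>
      (chartRep α.1 x (chartAt E x ((chartAt E x₀).symm z))).compContinuousLinearMap
        (fderiv ℝ (fun z => chartAt E x ((chartAt E x₀).symm z)) z) := by
    have h1 := (chartAt E x₀).open_target.mem_nhds hy
    have h2 : ∀ᶠ z in 𝓝 y, (chartAt E x₀).symm z ∈ (chartAt E x).source :=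
      ((chartAt E x₀).continuousAt_symm hy).eventually_mem ((chartAt E x).open_source.mem_nhds hxs)
    filter_upwards [h1, h2] with z hz hz'
    exact chartRep_change α.1 hz hz'
  have hd : DifferentiableAt ℝ (chartRep α.1 x) (chartAt E x ((chartAt E x₀).symm y)) :=
    ((α.2 x).contDiffAt ((chartAt E x).open_target.mem_nhds
      ((chartAt E x).map_source hxs))).differentiableAt (by simp)
  rw [hev.extDeriv_eq]
  refine Eq.trans ?_ (extDeriv_pullback (r := (⊤ : ℕ∞)) (f := fun z => chartAt E x ((chartAt E x₀).symm z))
    hd hT (by simpa using two_le_top)).symm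
  have h3 : fderiv ℝ (fun z => chartAt E x ((chartAt E x₀).symm z)) y =
      (mfderiv 𝓘(ℝ, E) 𝓘(ℝ, E) (chartAt E x) ((chartAt E x₀).symm y)).comp
        (mfderiv 𝓘(ℝ, E) 𝓘(ℝ, E) (chartAt E x₀).symm y) := by
    rw [← mfderiv_eq_fderiv]
    exact mfderiv_comp y
      ((mdifferentiable_chart (I := 𝓘(ℝ, E)) (M := M) x).mdifferentiableAt hxs)
      ((mdifferentiable_chart (I := 𝓘(ℝ, E)) (M := M) x₀).mdifferentiableAt_symm hy)
  rw [h3]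
  rfl

theorem contDiffOn_extDeriv {k : ℕ} {a : E → Alt E k} {s : Set E} (hs : IsOpen s)
    (ha : ContDiffOn ℝ (⊤ : ℕ∞) a s) : ContDiffOn ℝ (⊤ : ℕ∞) (extDeriv a) s :=
  (antisym E k).contDiff.comp_contDiffOn (ha.fderiv_of_isOpen hs (by simp))

theorem Form.differentiableAt {k : ℕ} (α : Form E M k) {x₀ : M} {y : E}
    (hy : y ∈ (chartAt E x₀).target) : DifferentiableAt ℝ (chartRep α.1 x₀) y :=
  ((α.2 x₀).contDiffAt ((chartAt E x₀).open_target.mem_nhds hy)).differentiableAt (by simp)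

/-- The exterior derivative `d : Ω^k(M) → Ω^(k+1)(M)`. -/
noncomputable def extD [IsManifold 𝓘(ℝ, E) (⊤ : ℕ∞) M] (k : ℕ) : Form E M k →ₗ[ℝ] Form E M (k + 1) where
  toFun α := ⟨extDerivFun α.1, fun x₀ =>
    (contDiffOn_extDeriv (chartAt E x₀).open_target (α.2 x₀)).congr
      fun _ hy => chartRep_extDerivFun α hy⟩
  map_add' α β := by
    refine Subtype.ext (funext fun x => ?_)
    have hx := mem_chart_target E x
    have h : extDeriv (chartRep (α + β).1 x) (chartAt E x x) =
        extDeriv (chartRep α.1 x) (chartAt E x x) + extDeriv (chartRep β.1 x) (chartAt E x x) :=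
      extDeriv_add (α.differentiableAt hx) (β.differentiableAt hx)
    change ContinuousAlternatingMap.compContinuousLinearMap (extDeriv (chartRep (α + β).1 x) _) _ = _
    rw [h]
    rfl
  map_smul' c α := by
    refine Subtype.ext (funext fun x => ?_)
    have h : extDeriv (chartRep (c • α).1 x) (chartAt E x x) =
        c • extDeriv (chartRep α.1 x) (chartAt E x x) :=
      extDeriv_smul c (chartRep α.1 x)
    change ContinuousAlternatingMap.compContinuousLinearMap (extDeriv (chartRep (c • α).1 x) _) _ = _
    rw [h]
    rfl

theorem chartRep_wedge {k l : ℕ} (α : ∀ x : M, TangentSpace 𝓘(ℝ, E) x [⋀^Fin k]→L[ℝ] ℝ)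
    (β : ∀ x : M, TangentSpace 𝓘(ℝ, E) x [⋀^Fin l]→L[ℝ] ℝ) (x₀ : M) (y : E) :
    chartRep (fun x => (wedge E k l (α x) (β x) : Alt E (l + k))) x₀ y =
      wedge E k l (chartRep α x₀ y) (chartRep β x₀ y) :=
  wedge_comp (E := E) (F := E) (α ((chartAt E x₀).symm y)) (β ((chartAt E x₀).symm y)) _

/-- The wedge product of differential forms. -/
noncomputable def wedgeForm (k l : ℕ) : Form E M k →ₗ[ℝ] Form E M l →ₗ[ℝ] Form E M (l + k) :=
  LinearMap.mk₂ ℝ (fun α β => ⟨fun x => (wedge E k l (α.1 x) (β.1 x) : Alt E (l + k)), fun x₀ => by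
      refine ContDiffOn.congr ?_ fun y _ => chartRep_wedge α.1 β.1 x₀ y
      exact ((wedge E k l).contDiff.comp_contDiffOn (α.2 x₀)).clm_apply (β.2 x₀)⟩)
    (fun a b c => Subtype.ext (funext fun x => by
      exact congrArg (fun T => T (c.1 x)) (map_add (wedge E k l) (a.1 x) (b.1 x))))
    (fun r a c => Subtype.ext (funext fun x => by
      exact congrArg (fun T => T (c.1 x)) (map_smul (wedge E k l) r (a.1 x))))
    (fun a b c => Subtype.ext (funext fun x => map_add (wedge E k l (a.1 x)) (b.1 x) (c.1 x)))
    (fun r a c => Subtype.ext (funext fun x => map_smul (wedge E k l (a.1 x)) r (c.1 x)))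

theorem chartRep_wedgeForm {k l : ℕ} (α : Form E M k) (β : Form E M l) (x₀ : M) :
    chartRep (wedgeForm k l α β).1 x₀ =
      fun y => wedge E k l (chartRep α.1 x₀ y) (chartRep β.1 x₀ y) :=
  funext fun y => chartRep_wedge α.1 β.1 x₀ y

variable [IsManifold 𝓘(ℝ, E) (⊤ : ℕ∞) M]

theorem Form.ext_chartRep {k : ℕ} {α β : Form E M k}
    (h : ∀ x₀ : M, ∀ y ∈ (chartAt E x₀).target, chartRep α.1 x₀ y = chartRep β.1 x₀ y) : α = β :=
  Subtype.ext (LCS.ext_chartRep fun x => h x _ (mem_chart_target E x))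

theorem chartRep_extD {k : ℕ} (α : Form E M k) {x₀ : M} {y : E}
    (hy : y ∈ (chartAt E x₀).target) :
    chartRep (extD k α).1 x₀ y = extDeriv (chartRep α.1 x₀) y := chartRep_extDerivFun α hy

theorem chartRep_extD_eventuallyEq {k : ℕ} (α : Form E M k) {x₀ : M} {y : E}
    (hy : y ∈ (chartAt E x₀).target) :
    chartRep (extD k α).1 x₀ =ᶠ[𝓝 y] extDeriv (chartRep α.1 x₀) := by
  filter_upwards [(chartAt E x₀).open_target.mem_nhds hy] with z hz
  exact chartRep_extDerivFun α hz

theorem extD_extD {k : ℕ} (α : Form E M k) : extD (k + 1) (extD k α) = 0 := by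
  refine Form.ext_chartRep fun x₀ y hy => ?_
  rw [chartRep_extD _ hy, (chartRep_extD_eventuallyEq α hy).extDeriv_eq]
  exact extDeriv_extDeriv_apply (r := (⊤ : ℕ∞))
    ((α.2 x₀).contDiffAt ((chartAt E x₀).open_target.mem_nhds hy))
    (by simpa using two_le_top)

theorem extD_wedge_one {l : ℕ} (θ : Form E M 1) (α : Form E M l) :
    extD (l + 1) (wedgeForm 1 l θ α) =
      wedgeForm 2 l (extD 1 θ) α - wedgeForm 1 (l + 1) θ (extD l α) := by
  refine Form.ext_chartRep fun x₀ y hy => ?_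
  rw [chartRep_extD _ hy, chartRep_wedgeForm,
    extDeriv_wedge_one (θ.differentiableAt hy) (α.differentiableAt hy),
    ← chartRep_extD θ hy, ← chartRep_extD α hy]
  change _ = chartRep (wedgeForm 2 l (extD 1 θ) α).1 x₀ y -
    chartRep (wedgeForm 1 (l + 1) θ (extD l α)).1 x₀ y
  rw [chartRep_wedgeForm, chartRep_wedgeForm]

theorem extD_wedge_two {l : ℕ} (ω : Form E M 2) (α : Form E M l) :
    extD (l + 2) (wedgeForm 2 l ω α) =
      wedgeForm 3 l (extD 2 ω) α + wedgeForm 2 (l + 1) ω (extD l α) := by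
  refine Form.ext_chartRep fun x₀ y hy => ?_
  rw [chartRep_extD _ hy, chartRep_wedgeForm,
    extDeriv_wedge_two (ω.differentiableAt hy) (α.differentiableAt hy),
    ← chartRep_extD ω hy, ← chartRep_extD α hy]
  change _ = chartRep (wedgeForm 3 l (extD 2 ω) α).1 x₀ y +
    chartRep (wedgeForm 2 (l + 1) ω (extD l α)).1 x₀ y
  rw [chartRep_wedgeForm, chartRep_wedgeForm]

/-- The Lichnerowicz differential `d_k α = d α + k θ ∧ α` on `m`-forms (`k` an integer). -/
noncomputable def lichD (θ : Form E M 1) (k : ℤ) (m : ℕ) : Form E M m →ₗ[ℝ] Form E M (m + 1) :=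
  extD m + (k : ℝ) • wedgeForm 1 m θ

theorem lichD_apply (θ : Form E M 1) (k : ℤ) {m : ℕ} (α : Form E M m) :
    lichD θ k m α = extD m α + (k : ℝ) • wedgeForm 1 m θ α := rfl

/-- `(M, ω, θ)` is a locally conformal symplectic manifold with Lee form `θ`: `ω` is a nondegenerate
`2`-form, `dω = -θ ∧ ω` (which is `-ω ∧ θ`, as `ω` has even degree), and `dθ = 0`. -/
structure IsLCS (ω : Form E M 2) (θ : Form E M 1) : Prop where
  nondegenerate : ∀ (x : M) (v : TangentSpace 𝓘(ℝ, E) x),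
    (∀ w : TangentSpace 𝓘(ℝ, E) x, ω.1 x ![v, w] = 0) → v = 0
  extD_omega : extD 2 ω = - wedgeForm 1 2 θ ω
  extD_theta : extD 1 θ = 0

theorem lichD_lichD {θ : Form E M 1} (hθ : extD 1 θ = 0) (k : ℤ) {m : ℕ} (α : Form E M m) :
    lichD θ k (m + 1) (lichD θ k m α) = 0 := by
  have h : wedgeForm 1 (m + 1) θ (wedgeForm 1 m θ α) = 0 :=
    Subtype.ext (funext fun x => wedge_one_self (E := E) (θ.1 x) (α.1 x))
  simp [lichD_apply, extD_extD, extD_wedge_one, hθ, h]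

/-- `d_k (ω ∧ α) = ω ∧ d_{k-1} α`. -/
theorem lichD_lefschetz {ω : Form E M 2} {θ : Form E M 1} (h : IsLCS ω θ) (k : ℤ) {m : ℕ}
    (α : Form E M m) :
    lichD θ k (m + 2) (wedgeForm 2 m ω α) = wedgeForm 2 (m + 1) ω (lichD θ (k - 1) m α) := by
  have h1 : wedgeForm 3 m (wedgeForm 1 2 θ ω) α = wedgeForm 1 (m + 2) θ (wedgeForm 2 m ω α) :=
    Subtype.ext (funext fun x => wedge_one_wedge (E := E) (θ.1 x) (ω.1 x) (α.1 x))
  have h2 : wedgeForm 2 (m + 1) ω (wedgeForm 1 m θ α) =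
      wedgeForm 1 (m + 2) θ (wedgeForm 2 m ω α) :=
    Subtype.ext (funext fun x => wedge_two_one (E := E) (ω.1 x) (θ.1 x) (α.1 x))
  rw [lichD_apply, lichD_apply, extD_wedge_two, h.extD_omega, map_neg, LinearMap.neg_apply, h1,
    map_add, map_smul, h2]
  push_cast
  rw [sub_smul, one_smul]
  have : ∀ a b c : Form E M (m + 3), -a + b + c = b + (c - a) := fun a b c => by abel
  exact this _ _ _

end Manifold


section FilteredComplex
universe u v

/-- A cochain complex `K⁰ → K¹ → ⋯` of modules with a decreasing filtration `F^p K^m` (`p ∈ ℤ`)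
by subcomplexes. -/
structure FilteredComplex (R : Type u) [Ring R] (K : ℕ → Type v) [∀ m, AddCommGroup (K m)]
    [∀ m, Module R (K m)] where
  d : ∀ m, K m →ₗ[R] K (m + 1)
  d_d : ∀ m (x : K m), d (m + 1) (d m x) = 0
  F : ℤ → ∀ m, Submodule R (K m)
  F_anti : ∀ {p p' : ℤ}, p ≤ p' → ∀ m, F p' m ≤ F p m
  d_mem : ∀ (p : ℤ) {m : ℕ} {x : K m}, x ∈ F p m → d m x ∈ F p (m + 1)

namespace FilteredComplex
variable {R : Type u} [Ring R] {K : ℕ → Type v} [∀ m, AddCommGroup (K m)] [∀ m, Module R (K m)]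
  (C : FilteredComplex R K)

/-- The coboundaries `d(K^(m-1))` in `K^m`. -/
def coboundaries : ∀ m, Submodule R (K m)
  | 0 => ⊥
  | m + 1 => LinearMap.range (C.d m)

abbrev cocycles (m : ℕ) : Submodule R (K m) := LinearMap.ker (C.d m)

/-- The cohomology `H^m = ker d / im d` of the complex in degree `m`. -/
abbrev H (m : ℕ) : Type v := C.cocycles m ⧸ (C.coboundaries m).submoduleOf (C.cocycles m)

/-- `Z_r^{p,q} = F^p K^m ∩ d⁻¹(F^{p+r} K^{m+1})`, where `m = p + q`. -/
def Z (r p : ℤ) (m : ℕ) : Submodule R (K m) := C.F p m ⊓ (C.F (p + r) (m + 1)).comap (C.d m)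

/-- `B_r^{p,q} = F^p K^m ∩ d(F^{p-r} K^{m-1})`, where `m = p + q`. -/
def B (r p : ℤ) : ∀ m, Submodule R (K m)
  | 0 => ⊥
  | m + 1 => C.F p (m + 1) ⊓ (C.F (p - r) m).map (C.d m)

/-- `Z_{r-1}^{p+1,q-1} + B_{r-1}^{p,q}`, where `m = p + q`. -/
def denom (r p : ℤ) (m : ℕ) : Submodule R (K m) := C.Z (r - 1) (p + 1) m ⊔ C.B (r - 1) p m

/-- The term `E_r^{p,q} = Z_r^{p,q} / (Z_{r-1}^{p+1,q-1} + B_{r-1}^{p,q})` of the spectral sequence of the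
filtered complex. It is indexed by `r`, `p` and the total degree `m = p + q`; thus `E_r^{p,q}` is
`C.page r p (p + q)`. Terms of negative total degree vanish and are left out. -/
abbrev page (r p : ℤ) (m : ℕ) : Type v := C.Z r p m ⧸ (C.denom r p m).submoduleOf (C.Z r p m)

theorem d_mem_Z {r p : ℤ} {m : ℕ} {x : K m} (hx : x ∈ C.Z r p m) :
    C.d m x ∈ C.Z r (p + r) (m + 1) :=
  ⟨hx.2, by
    rw [SetLike.mem_coe, Submodule.mem_comap, C.d_d]
    exact Submodule.zero_mem _⟩

theorem d_mem_denom {r p : ℤ} {m : ℕ} {x : K m} (hx : x ∈ C.denom r p m) :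
    C.d m x ∈ C.denom r (p + r) (m + 1) := by
  obtain ⟨z, hz, b, hb, rfl⟩ := Submodule.mem_sup.mp hx
  have hb0 : C.d m b = 0 := by
    cases m with
    | zero =>
      have : b = 0 := hb
      rw [this, map_zero]
    | succ m =>
      obtain ⟨y, _, rfl⟩ := hb.2
      exact C.d_d m y
  rw [map_add, hb0, add_zero]
  refine Submodule.mem_sup_right ⟨?_, z, ?_, rfl⟩
  · have h := hz.2
    rwa [show p + 1 + (r - 1) = p + r by ring] at h
  · rw [show p + r - (r - 1) = p + 1 by ring]
    exact hz.1

/-- The differential `d_r : E_r^{p,q} → E_r^{p+r,q-r+1}`, `[x] ↦ [d x]`. -/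
def differential (r p : ℤ) (m : ℕ) : C.page r p m →ₗ[R] C.page r (p + r) (m + 1) :=
  Submodule.mapQ _ _ ((C.d m).restrict fun _ hx => C.d_mem_Z hx) fun _ hx => C.d_mem_denom hx

/-- The class of a cocycle in cohomology. -/
def classH {m : ℕ} (x : K m) (hx : C.d m x = 0) : C.H m :=
  Submodule.Quotient.mk ⟨x, hx⟩

/-- The class in `E_r^{p,q}` of an element of `Z_r^{p,q}`. -/
def classPage {r p : ℤ} {m : ℕ} (x : K m) (hx : x ∈ C.Z r p m) : C.page r p m :=
  Submodule.Quotient.mk ⟨x, hx⟩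

/-- `E_r^{p,q} = H^{p+q}` (with `m = p + q`) canonically: every cocycle of degree `m` lies in `Z_r^{p,q}`, and
assigning to the cohomology class of a cocycle its class in `E_r^{p,q}` is a well-defined linear
isomorphism. -/
def IsoToCohomology (r p : ℤ) (m : ℕ) : Prop :=
  ∃ e : C.H m ≃ₗ[R] C.page r p m, ∀ (x : K m) (hx : C.d m x = 0),
    ∃ hZ : x ∈ C.Z r p m, e (C.classH x hx) = C.classPage x hZ

theorem Z_le (r p : ℤ) (m : ℕ) : C.Z (r + 1) p m ≤ C.Z r p m :=
  fun _ hx => ⟨hx.1, C.F_anti (by omega) _ hx.2⟩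

/-- The spectral sequence stabilizes at `E_s`: for all `r ≥ s` the differentials `d_r` vanish, and
`[x] ↦ [x]` is an isomorphism of `E_{r+1}^{p,q}` onto `E_r^{p,q}`. -/
def StabilizesAt (s : ℤ) : Prop :=
  ∀ r : ℤ, s ≤ r → ∀ (p : ℤ) (m : ℕ), C.differential r p m = 0 ∧
    ∃ e : C.page (r + 1) p m ≃ₗ[R] C.page r p m, ∀ (x : K m) (hx : x ∈ C.Z (r + 1) p m),
      e (C.classPage x hx) = C.classPage x (C.Z_le r p m hx)

end FilteredComplex
end FilteredComplex

section LefschetzComplex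
variable {E : Type*} [NormedAddCommGroup E] [NormedSpace ℝ E]
  {M : Type*} [TopologicalSpace M] [ChartedSpace E M]

/-- The filtration `F^p Ω^m = L^p Ω^(m-2p)`, where `L α = ω ∧ α`, of `m`-forms by the powers of `L`; it is `0`
for `m < 2p`. -/
noncomputable def lefschetzFil (ω : Form E M 2) : ℕ → ∀ m, Submodule ℝ (Form E M m)
  | 0, _ => ⊤
  | _ + 1, 0 => ⊥
  | _ + 1, 1 => ⊥
  | p + 1, m + 2 => (lefschetzFil ω p m).map (wedgeForm 2 m ω)

theorem lefschetzFil_succ_le (ω : Form E M 2) (p m : ℕ) :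
    lefschetzFil ω (p + 1) m ≤ lefschetzFil ω p m := by
  induction p generalizing m with
  | zero => exact le_top
  | succ p ih =>
    match m with
    | 0 => exact le_rfl
    | 1 => exact le_rfl
    | m + 2 => exact Submodule.map_mono (ih m)

theorem lichD_mem_lefschetzFil [IsManifold 𝓘(ℝ, E) (⊤ : ℕ∞) M] {ω : Form E M 2} {θ : Form E M 1}
    (h : IsLCS ω θ) (k : ℤ) (p : ℕ) {m : ℕ} {α : Form E M m} (hα : α ∈ lefschetzFil ω p m) :
    lichD θ k m α ∈ lefschetzFil ω p (m + 1) := by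
  induction p generalizing m k with
  | zero => exact Submodule.mem_top
  | succ p ih =>
    rcases m with _ | _ | m
    · have : α = 0 := hα
      rw [this, map_zero]
      exact Submodule.zero_mem _
    · have : α = 0 := hα
      rw [this, map_zero]
      exact Submodule.zero_mem _
    · obtain ⟨β, hβ, rfl⟩ := hα
      exact ⟨lichD θ (k - 1) m β, ih (k - 1) hβ, (lichD_lefschetz h k β).symm⟩

/-- The filtered complex `(Ω^*(M), d_k)` with the filtration `F^p = L^p Ω^*(M)` (and `F^p = Ω^*(M)` for
`p ≤ 0`) of a locally conformal symplectic manifold. Its cohomology is the Lichnerowicz-Novikov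
cohomology `H^*_k(M)`, its spectral sequence is `E^{p,q}_{k,r}`. -/
noncomputable def lcsComplex [IsManifold 𝓘(ℝ, E) (⊤ : ℕ∞) M] {ω : Form E M 2} {θ : Form E M 1}
    (h : IsLCS ω θ) (k : ℤ) : FilteredComplex ℝ (Form E M) where
  d m := lichD θ k m
  d_d _ α := lichD_lichD h.extD_theta k α
  F p m := lefschetzFil ω p.toNat m
  F_anti hp m := antitone_nat_of_succ_le (f := fun p => lefschetzFil ω p m)
    (fun p => lefschetzFil_succ_le ω p m) (Int.toNat_le_toNat hp)
  d_mem p _ _ hx := lichD_mem_lefschetzFil h k p.toNat hx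

end LefschetzComplex

end LCS

namespace LCS

/-! ### Interior products of wedge products. -/

section PointwiseLefschetz
variable {E : Type*} [NormedAddCommGroup E] [NormedSpace ℝ E]

/-! Write `L` for multiplication by `ω`. Two facts drive everything.

The first is hard Lefschetz on `Λ^*E*`, where `dim E = 2n`: `L^k` is injective on `j`-forms if `j +
k ≤ n`, and bijective if `j + k = n` (`Nondegenerate.lefschetzPow_injective`,
`Nondegenerate.lefschetzPow_bijective`). It follows from the `sl₂` relation between `L` and the
contraction `Λ` with the inverse bivector, and it passes to smooth forms. Hence `F^p Ω^m = Ω^m` for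
`m ≥ n + p`, and `L` is injective on `F^p Ω^m` for `m < n + p`.

The second is that exactness of `ω` makes `L` zero on cohomology: if `d_{k-1} α = 0` then `ω ∧ α =
d_k (τ ∧ α)` (`wedgeForm_lichD`).

Together they give `IsLCS.exists_lichD_eq`: in degrees at most `n + p`, a closed form in `F^{p+1}`
is the differential of a form in `F^p`. Indeed, if `L β` is closed then so is `β`, for the weight `k
- 1`, by injectivity of `L`; one descends until `F^1` is reached, where `τ` supplies the primitive.

Consequently every `x ∈ F^p` with `d x ∈ F^{p+2}` is a cocycle in `F^p` modulo `F^{p+1}`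
(`IsLCS.exists_cocycle`): in low degrees `d x` has a primitive in `F^{p+1}`, which is subtracted
from `x`; in high degrees `F^{p+1}` is everything. So all classes of `E_2` are represented by
cocycles, which forces degeneration. The vanishing range and the two edges follow by deciding which
cocycles are exact and where their primitives lie. -/

theorem antisym_contract {k : ℕ} (a : Alt E (k + 1)) :
    antisym E k (contract E k a) = ((k : ℝ) + 1) • a := by
  have h := ContinuousAlternatingMap.alternatizeUncurryFin_curryLeft a
  rw [← Nat.cast_smul_eq_nsmul ℝ] at h
  push_cast at h
  exact h

theorem contract_contract_swap {k : ℕ} (a : Alt E (k + 2)) (x y : E) :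
    contract E k (contract E (k + 1) a x) y = - contract E k (contract E (k + 1) a y) x := by
  ext v
  change a (Matrix.vecCons x (Matrix.vecCons y v)) = - a (Matrix.vecCons y (Matrix.vecCons x v))
  refine Eq.trans ?_ (a.map_swap _ (show (0 : Fin (k + 2)) ≠ 1 by simp))
  refine congrArg a (funext fun i => ?_)
  refine Fin.cases ?_ (fun i => ?_) i
  · simp
  · refine Fin.cases ?_ (fun i => ?_) i
    · simp
    · simp only [Function.comp_apply]
      rw [Equiv.swap_apply_of_ne_of_ne] <;> simp [Fin.ext_iff]

theorem wedge_one_eq {l : ℕ} (a : Alt E 1) (b : Alt E l) :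
    wedge E 1 l a b = antisym E l (((wedge E 0 l).flip b).comp (contract E 0 a)) := by
  rw [wedge_succ]; simp

theorem contract_wedge_one_zero (a : Alt E 1) (b : Alt E 0) (x : E) :
    contract E 0 (wedge E 1 0 a b) x = a ![x] • b := by
  rw [wedge_one_eq, contract_antisym_zero]
  exact wedge_zero _ _

theorem contract_wedge_one {l : ℕ} (a : Alt E 1) (b : Alt E (l + 1)) (x : E) :
    contract E (l + 1) (wedge E 1 (l + 1) a b) x = a ![x] • b - wedge E 1 l a (contract E l b x) := by
  rw [wedge_one_eq, contract_antisym, wedge_one_eq]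
  congr 1
  exact wedge_zero _ _

theorem wedge_two_eq {l : ℕ} (a : Alt E 2) (b : Alt E l) :
    (2 : ℝ) • wedge E 2 l a b = antisym E (l + 1) (((wedge E 1 l).flip b).comp (contract E 1 a)) := by
  rw [wedge_succ, smul_smul]; norm_num

theorem contract_wedge_two_zero (a : Alt E 2) (b : Alt E 0) (x : E) :
    contract E 1 (wedge E 2 0 a b) x = wedge E 1 0 (contract E 1 a x) b := by
  have h : (2 : ℝ) • contract E 1 (wedge E 2 0 a b) x =
      (2 : ℝ) • wedge E 1 0 (contract E 1 a x) b := by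
    change ((2 : ℝ) • contract E 1 (wedge E 2 0 a b)) x = _
    rw [← map_smul, wedge_two_eq, contract_antisym, two_smul, sub_eq_add_neg]
    congr 1
    rw [wedge_one_eq, ← map_neg]
    congr 1
    ext1 y
    change - contract E 0 (wedge E 1 0 (contract E 1 a y) b) x =
      wedge E 0 0 (contract E 0 (contract E 1 a x) y) b
    rw [contract_wedge_one_zero, wedge_zero, contract_contract_swap, ← neg_smul]
    rfl
  exact smul_right_injective _ (two_ne_zero' ℝ) h

/-- Doubling removes the factor `1/2` from the recursive definition of the product. Then
`contract_antisym` gives `ι_x a ∧ b` once, and the remaining term, after `a(y, x) = -a(x, y)`, gives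
it a second time together with `2 a ∧ ι_x b`. -/
theorem contract_wedge_two {l : ℕ} (a : Alt E 2) (b : Alt E (l + 1)) (x : E) :
    contract E (l + 2) (wedge E 2 (l + 1) a b) x =
      wedge E 1 (l + 1) (contract E 1 a x) b + wedge E 2 l a (contract E l b x) := by
  refine smul_right_injective _ (two_ne_zero' ℝ) ?_
  change ((2 : ℝ) • contract E (l + 2) (wedge E 2 (l + 1) a b)) x = (2 : ℝ) • _
  rw [← map_smul, wedge_two_eq, contract_antisym, smul_add, wedge_two_eq, two_smul, sub_eq_add_neg]
  refine Eq.trans ?_ (add_assoc _ _ _).symm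
  congr 1
  have h := wedge_one_eq (contract E 1 a x) b
  refine Eq.trans ?_ (congrArg (· + _) h.symm)
  rw [← map_neg, ← map_add]
  congr 1
  ext1 y
  change - contract E (l + 1) (wedge E 1 (l + 1) (contract E 1 a y) b) x =
    wedge E 0 (l + 1) (contract E 0 (contract E 1 a x) y) b +
      wedge E 1 l (contract E 1 a y) (contract E l b x)
  rw [contract_wedge_one, wedge_zero, contract_contract_swap, neg_sub, sub_eq_add_neg]
  refine (add_comm _ _).trans (congrArg (· + _) ?_)
  rw [← neg_smul]
  rfl

/-! ### The inverse bivector and the commutator of `Λ` with `L`. -/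

/-- A `2`-form is nondegenerate if only the zero vector contracts it to zero. -/
def Nondegenerate (a : Alt E 2) : Prop :=
  ∀ v : E, (∀ w : E, a ![v, w] = 0) → v = 0

/-- The hypothesis says that the tensor `∑ a_i ⊗ f_i` is `c` times the identity, so the sum reduces
to Euler's identity `∑ e^i ∧ ι_{e_i} b = deg(b) b`, which is `antisym_contract`. -/
theorem sum_wedge_one {ι : Type*} [Fintype ι] {l : ℕ} {a : ι → Alt E 1} {f : ι → E} {c : ℝ}
    (h : ∀ y, ∑ i, a i ![y] • f i = c • y) (b : Alt E (l + 1)) :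
    ∑ i, wedge E 1 l (a i) (contract E l b (f i)) = (c * ((l : ℝ) + 1)) • b := by
  rw [mul_smul, ← antisym_contract, ← map_smul]
  simp_rw [wedge_one_eq]
  rw [← map_sum]
  congr 1
  ext1 y
  change _ = c • contract E l b y
  rw [← map_smul, ← h, map_sum, sum_apply]
  refine Finset.sum_congr rfl fun i _ => ?_
  rw [map_smul]
  exact wedge_zero _ _

/-- The sum of the double contractions with the pairs of vectors `f i`, `e i`. -/
noncomputable def bivectorContract {ι : Type*} [Fintype ι] (e f : ι → E) (k : ℕ) :
    Alt E (k + 2) →ₗ[ℝ] Alt E k where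
  toFun b := ∑ i, contract E k (contract E (k + 1) b (f i)) (e i)
  map_add' b c := by simp [Finset.sum_add_distrib]
  map_smul' r b := by simp [Finset.smul_sum]

theorem bivectorContract_apply {ι : Type*} [Fintype ι] (e f : ι → E) {k : ℕ} (b : Alt E (k + 2)) :
    bivectorContract e f k b = ∑ i, contract E k (contract E (k + 1) b (f i)) (e i) := rfl

/-- The bivector `∑ e i ⊗ f i` is inverse to the `2`-form `a`. -/
structure IsInverseBivector {ι : Type*} [Fintype ι] (a : Alt E 2) (e f : ι → E) : Prop where
  left : ∀ y, ∑ i, a ![f i, y] • e i = y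
  right : ∀ y, ∑ i, a ![e i, y] • f i = - y
  trace : ∑ i, a ![f i, e i] = Module.finrank ℝ E

section
variable {ι : Type*} [Fintype ι] {a : Alt E 2} {e f : ι → E}

theorem IsInverseBivector.sum_left (h : IsInverseBivector a e f) {l : ℕ} (b : Alt E (l + 1)) :
    ∑ i, wedge E 1 l (contract E 1 a (f i)) (contract E l b (e i)) = ((l : ℝ) + 1) • b := by
  rw [sum_wedge_one (c := 1), one_mul]
  intro y
  rw [one_smul]
  exact h.left y

theorem IsInverseBivector.sum_right (h : IsInverseBivector a e f) {l : ℕ} (b : Alt E (l + 1)) :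
    ∑ i, wedge E 1 l (contract E 1 a (e i)) (contract E l b (f i)) = (-((l : ℝ) + 1)) • b := by
  rw [sum_wedge_one (c := -1), neg_one_mul]
  intro y
  rw [neg_one_smul]
  exact h.right y

theorem IsInverseBivector.sum_smul (h : IsInverseBivector a e f) {l : ℕ} (b : Alt E l) :
    ∑ i, contract E 1 a (f i) ![e i] • b = (Module.finrank ℝ E : ℝ) • b := by
  rw [← Finset.sum_smul, ← h.trace]
  rfl

theorem IsInverseBivector.bivectorContract_wedge_zero (h : IsInverseBivector a e f) (b : Alt E 0) :
    bivectorContract e f 0 (wedge E 2 0 a b) = (Module.finrank ℝ E : ℝ) • b := by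
  rw [← h.sum_smul, bivectorContract_apply]
  refine Finset.sum_congr rfl fun i _ => ?_
  rw [contract_wedge_two_zero, contract_wedge_one_zero]

theorem IsInverseBivector.bivectorContract_wedge_one (h : IsInverseBivector a e f) (b : Alt E 1) :
    bivectorContract e f 1 (wedge E 2 1 a b) = ((Module.finrank ℝ E : ℝ) - 2) • b := by
  have key : ∀ i, contract E 1 (contract E 2 (wedge E 2 1 a b) (f i)) (e i) =
      contract E 1 a (f i) ![e i] • b - wedge E 1 0 (contract E 1 a (f i)) (contract E 0 b (e i)) +
        wedge E 1 0 (contract E 1 a (e i)) (contract E 0 b (f i)) := by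
    intro i
    rw [contract_wedge_two, map_add, add_apply, contract_wedge_one,
      contract_wedge_two_zero]
  rw [bivectorContract_apply, Finset.sum_congr rfl fun i _ => key i, Finset.sum_add_distrib,
    Finset.sum_sub_distrib, h.sum_smul, h.sum_left, h.sum_right, ← sub_smul, ← add_smul]
  congr 1
  push_cast
  ring

/-- The Leibniz rule applied twice to `ι_e ι_f (a ∧ b)` gives four terms. One is `a ∧ ι_e ι_f b`;
the others sum to `dim E`, `-(l + 2)` and `-(l + 2)` times `b`, by the trace and the two identities
for the inverse bivector. Degrees `0` and `1` are treated separately because some contractions are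
absent there. -/
theorem IsInverseBivector.bivectorContract_wedge (h : IsInverseBivector a e f) {l : ℕ}
    (b : Alt E (l + 2)) :
    bivectorContract e f (l + 2) (wedge E 2 (l + 2) a b) =
      wedge E 2 l a (bivectorContract e f l b) +
        ((Module.finrank ℝ E : ℝ) - 2 * ((l : ℝ) + 2)) • b := by
  have key : ∀ i, contract E (l + 2) (contract E (l + 3) (wedge E 2 (l + 2) a b) (f i)) (e i) =
      contract E 1 a (f i) ![e i] • b -
        wedge E 1 (l + 1) (contract E 1 a (f i)) (contract E (l + 1) b (e i)) +
        (wedge E 1 (l + 1) (contract E 1 a (e i)) (contract E (l + 1) b (f i)) +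
          wedge E 2 l a (contract E l (contract E (l + 1) b (f i)) (e i))) := by
    intro i
    rw [contract_wedge_two, map_add, add_apply, contract_wedge_one,
      contract_wedge_two]
  rw [bivectorContract_apply, Finset.sum_congr rfl fun i _ => key i, Finset.sum_add_distrib,
    Finset.sum_sub_distrib, Finset.sum_add_distrib, h.sum_smul, h.sum_left, h.sum_right,
    bivectorContract_apply, map_sum, ← add_assoc, ← sub_smul, ← add_smul]
  refine (add_comm _ _).trans ?_
  congr 2
  push_cast
  ring
end

/-- Take a basis `e` and let `f i` be the vector that the isomorphism `v ↦ a(v, ·)` sends to the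
dual basis covector `e^i`. -/
theorem Nondegenerate.exists_isInverseBivector [FiniteDimensional ℝ E] {a : Alt E 2}
    (ha : Nondegenerate a) :
    ∃ e f : Fin (Module.finrank ℝ E) → E, IsInverseBivector a e f := by
  have hswap : ∀ v w : E, a ![v, w] = - a ![w, v] := fun v w => by
    have := congrArg (fun c : Alt E 0 => c ![]) (contract_contract_swap a v w)
    exact this
  have hlin : ∀ w : E, ∀ g : E →L[ℝ] Alt E 1, g = contract E 1 a → ∀ v, a ![v, w] = g v ![w] := by
    rintro w g rfl v; rfl
  let φ : E →ₗ[ℝ] Module.Dual ℝ E := LinearMap.mk₂ ℝ (fun v w => a ![v, w])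
    (fun v v' w => by simp [hlin w _ rfl]) (fun c v w => by simp [hlin w _ rfl])
    (fun v w w' => by simp [hswap v, hlin v _ rfl]; ring) (fun c v w => by
      simp [hswap v, hlin v _ rfl])
  have hφ : ∀ v w, φ v w = a ![v, w] := fun _ _ => rfl
  have hinj : Function.Injective φ := by
    rw [injective_iff_map_eq_zero]
    intro v hv
    exact ha v fun w => by rw [← hφ, hv]; rfl
  have hsurj : Function.Surjective φ :=
    (LinearMap.injective_iff_surjective_of_finrank_eq_finrank
      (Subspace.dual_finrank_eq (K := ℝ) (V := E)).symm).mp hinj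
  let e := Module.finBasis ℝ E
  choose f hf using fun i => hsurj (e.coord i)
  have hf' : ∀ i w, a ![f i, w] = e.repr w i := fun i w => by rw [← hφ, hf]; rfl
  refine ⟨e, f, ⟨fun y => ?_, fun y => ?_, ?_⟩⟩
  · simp_rw [hf']
    exact e.sum_repr y
  -- Pairing with `w` turns the sum into `∑ e^i(w) a(e_i, y) = a(w, y) = -a(y, w)`; this is the
  -- origin of the sign.
  · apply hinj
    ext w
    rw [map_sum, map_neg, LinearMap.sum_apply, LinearMap.neg_apply, hφ y, hswap y, neg_neg]
    have hw : a ![w, y] = ∑ i, e.repr w i * a ![e i, y] := by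
      rw [← hφ]
      conv_lhs => rw [← e.sum_repr w, map_sum, LinearMap.sum_apply]
      refine Finset.sum_congr rfl fun i _ => ?_
      rw [map_smul, LinearMap.smul_apply, hφ, smul_eq_mul]
    rw [hw]
    refine Finset.sum_congr rfl fun i _ => ?_
    simp [hφ, hf', mul_comm]
  · simp [hf']

/-! ### The `sl₂` argument on sequences of forms, where degrees such as `(j - 2) + 2` need no
transport. -/

/-- The iterated Lefschetz map `b ↦ a ∧ ⋯ ∧ a ∧ b` on alternating forms. -/
noncomputable def lefschetzPow (a : Alt E 2) (j : ℕ) : (k : ℕ) → Alt E j →L[ℝ] Alt E (j + 2 * k)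
  | 0 => ContinuousLinearMap.id ℝ _
  | k + 1 => (wedge E 2 (j + 2 * k) a).comp (lefschetzPow a j k)

theorem lefschetzPow_succ (a : Alt E 2) (j k : ℕ) (b : Alt E j) :
    lefschetzPow a j (k + 1) b = wedge E 2 (j + 2 * k) a (lefschetzPow a j k b) := rfl

/-- The Lefschetz map on sequences of alternating forms of all degrees. -/
noncomputable def totalWedge (a : Alt E 2) : (∀ m, Alt E m) →ₗ[ℝ] ∀ m, Alt E m :=
  LinearMap.pi fun m => match m with
    | 0 => 0
    | 1 => 0
    | m + 2 => (wedge E 2 m a).toLinearMap.comp (LinearMap.proj m)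

theorem totalWedge_zero (a : Alt E 2) (v : ∀ m, Alt E m) : totalWedge a v 0 = 0 := rfl

theorem totalWedge_one (a : Alt E 2) (v : ∀ m, Alt E m) : totalWedge a v 1 = 0 := rfl

theorem totalWedge_add_two (a : Alt E 2) (v : ∀ m, Alt E m) (m : ℕ) :
    totalWedge a v (m + 2) = wedge E 2 m a (v m) := rfl

/-- The contraction with a bivector on sequences of alternating forms of all degrees. -/
noncomputable def totalContract {ι : Type*} [Fintype ι] (e f : ι → E) :
    (∀ m, Alt E m) →ₗ[ℝ] ∀ m, Alt E m :=
  LinearMap.pi fun m => (bivectorContract e f m).comp (LinearMap.proj (m + 2))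

theorem totalContract_apply {ι : Type*} [Fintype ι] (e f : ι → E) (v : ∀ m, Alt E m) (m : ℕ) :
    totalContract e f v m = bivectorContract e f m (v (m + 2)) := rfl

/-- A sequence of alternating forms concentrated in degree `j`. -/
def IsHomogeneous (j : ℕ) (v : ∀ m, Alt E m) : Prop := ∀ m, m ≠ j → v m = 0

theorem isHomogeneous_single {j : ℕ} (b : Alt E j) : IsHomogeneous j (Pi.single j b) :=
  fun _ hm => Pi.single_eq_of_ne hm _

theorem IsHomogeneous.totalWedge {j : ℕ} {v : ∀ m, Alt E m} (hv : IsHomogeneous j v) (a : Alt E 2) :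
    IsHomogeneous (j + 2) (totalWedge a v) := by
  intro m hm
  match m with
  | 0 => rfl
  | 1 => rfl
  | m + 2 => rw [totalWedge_add_two, hv m (by omega), map_zero]

theorem IsHomogeneous.totalWedge_pow {j : ℕ} {v : ∀ m, Alt E m} (hv : IsHomogeneous j v)
    (a : Alt E 2) (k : ℕ) : IsHomogeneous (j + 2 * k) ((LCS.totalWedge a ^ k) v) := by
  induction k with
  | zero => exact hv
  | succ k ih =>
    rw [pow_succ']
    exact ih.totalWedge a

section
variable {ι : Type*} [Fintype ι] {a : Alt E 2} {e f : ι → E}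

theorem IsHomogeneous.totalContract {j : ℕ} {v : ∀ m, Alt E m} (hv : IsHomogeneous (j + 2) v)
    (e f : ι → E) : IsHomogeneous j (totalContract e f v) := by
  intro m hm
  rw [totalContract_apply, hv _ (by omega), map_zero]

theorem IsHomogeneous.totalContract_eq_zero {j : ℕ} (hj : j < 2) {v : ∀ m, Alt E m}
    (hv : IsHomogeneous j v) (e f : ι → E) : LCS.totalContract e f v = 0 := by
  funext m
  rw [totalContract_apply, hv _ (by omega), map_zero]
  rfl

theorem IsInverseBivector.totalContract_totalWedge (h : IsInverseBivector a e f) {j : ℕ}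
    {v : ∀ m, Alt E m} (hv : IsHomogeneous j v) :
    totalContract e f (totalWedge a v) = totalWedge a (totalContract e f v) +
      ((Module.finrank ℝ E : ℝ) - 2 * j) • v := by
  have key : ∀ m, totalContract e f (totalWedge a v) m = totalWedge a (totalContract e f v) m +
      ((Module.finrank ℝ E : ℝ) - 2 * m) • v m := by
    intro m
    match m with
    | 0 =>
      refine (h.bivectorContract_wedge_zero (v 0)).trans ?_
      rw [totalWedge_zero]
      simp
    | 1 =>
      refine (h.bivectorContract_wedge_one (v 1)).trans ?_
      rw [totalWedge_one]
      simp
    | m + 2 =>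
      refine (h.bivectorContract_wedge (v (m + 2))).trans ?_
      push_cast
      rfl
  funext m
  rw [key m]
  by_cases hm : m = j
  · subst hm; rfl
  · simp [hv m hm]

theorem totalWedge_pow_succ_apply (a : Alt E 2) (k : ℕ) (v : ∀ m, Alt E m) :
    (totalWedge a ^ (k + 1)) v = totalWedge a ((totalWedge a ^ k) v) := by
  rw [pow_succ', Module.End.mul_apply]

/-- Commuting `Λ` past each `L` in turn adds the weights `dim E - 2(j + 2i)` for `i = 0, …, k`,
whose sum is the stated coefficient. -/
theorem IsInverseBivector.totalContract_totalWedge_pow (h : IsInverseBivector a e f) {j : ℕ}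
    {v : ∀ m, Alt E m} (hv : IsHomogeneous j v) (k : ℕ) :
    totalContract e f ((totalWedge a ^ (k + 1)) v) =
      (totalWedge a ^ (k + 1)) (totalContract e f v) +
        (((k : ℝ) + 1) * ((Module.finrank ℝ E : ℝ) - 2 * j - 2 * k)) • (totalWedge a ^ k) v := by
  induction k with
  | zero => simpa using h.totalContract_totalWedge hv
  | succ k ih =>
    rw [totalWedge_pow_succ_apply _ (k + 1),
      h.totalContract_totalWedge (hv.totalWedge_pow a (k + 1)), ih, map_add, map_smul,
      ← totalWedge_pow_succ_apply, ← totalWedge_pow_succ_apply, add_assoc, ← add_smul]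
    congr 2
    push_cast
    ring

/-- A double induction, on the degree and on the power, replaces the primitive decomposition:
`L^{k+1} v = 0` first forces `Λ v = 0`, and then the commutator formula gives `L^k v = 0`, since its
coefficient is positive in this range. -/
theorem IsInverseBivector.eq_zero_of_totalWedge_pow (h : IsInverseBivector a e f) {j k : ℕ}
    (hjk : 2 * (j + k) ≤ Module.finrank ℝ E) {v : ∀ m, Alt E m} (hv : IsHomogeneous j v)
    (h0 : (totalWedge a ^ k) v = 0) : v = 0 := by
  induction j using Nat.strong_induction_on generalizing k v with
  | _ j ihj =>
    induction k with
    | zero => simpa using h0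
    | succ k ihk =>
      have hc := h.totalContract_totalWedge_pow hv k
      have hv0 : totalContract e f v = 0 := by
        rcases Nat.lt_or_ge j 2 with hj | hj
        · exact hv.totalContract_eq_zero hj e f
        · obtain ⟨i, rfl⟩ := Nat.exists_eq_add_of_le' hj
          -- Applying `L` to the commutator formula leaves `L^{k+2} Λ v = 0`. Passing from `(j, k +
          -- 1)` to `(j - 2, k + 2)` preserves the bound.
          refine ihj i (by omega) (k := k + 2) (by omega) (hv.totalContract e f) ?_
          have h1 := congrArg (totalWedge a) hc
          rw [h0, map_zero, map_zero, map_add, map_smul,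
            ← totalWedge_pow_succ_apply, ← totalWedge_pow_succ_apply, h0, smul_zero, add_zero] at h1
          exact h1.symm
      rw [h0, hv0, map_zero, map_zero, zero_add] at hc
      refine ihk (by omega) ((smul_eq_zero.mp hc.symm).resolve_left ?_)
      have h2 : (2 : ℝ) * (j + (k + 1)) ≤ Module.finrank ℝ E := by exact_mod_cast hjk
      have : (0 : ℝ) < (Module.finrank ℝ E : ℝ) - 2 * j - 2 * k := by linarith
      positivity
end

theorem totalWedge_pow_single (a : Alt E 2) {j : ℕ} (b : Alt E j) (k : ℕ) :
    (totalWedge a ^ k) (Pi.single j b) = Pi.single (j + 2 * k) (lefschetzPow a j k b) := by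
  induction k with
  | zero => rfl
  | succ k ih =>
    rw [totalWedge_pow_succ_apply, ih]
    have hh := (isHomogeneous_single (lefschetzPow a j k b)).totalWedge a
    funext m
    by_cases hm : m = j + 2 * k + 2
    · subst hm
      rw [totalWedge_add_two, Pi.single_eq_same]
      exact (Pi.single_eq_same (M := fun m => Alt E m) (j + 2 * (k + 1))
        (lefschetzPow a j (k + 1) b)).symm
    · rw [hh m hm]
      exact (Pi.single_eq_of_ne (M := fun m => Alt E m) hm _).symm

theorem Nondegenerate.lefschetzPow_injective [FiniteDimensional ℝ E] {a : Alt E 2}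
    (ha : Nondegenerate a) {j k : ℕ} (hjk : 2 * (j + k) ≤ Module.finrank ℝ E) :
    Function.Injective (lefschetzPow a j k) := by
  obtain ⟨e, f, h⟩ := ha.exists_isInverseBivector
  rw [injective_iff_map_eq_zero]
  intro b hb
  have := h.eq_zero_of_totalWedge_pow hjk (isHomogeneous_single b) (by
    rw [totalWedge_pow_single, hb, Pi.single_zero])
  simpa using this

/-! ### Pullback, smooth dependence on the `2`-form, and bijectivity by dimension count. -/

theorem Nondegenerate.comp {F : Type*} [NormedAddCommGroup F] [NormedSpace ℝ F] {a : Alt E 2}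
    (ha : Nondegenerate a) (g : F ≃L[ℝ] E) :
    Nondegenerate (a.compContinuousLinearMap (g : F →L[ℝ] E)) := by
  intro v hv
  have : g v = 0 := ha _ fun w => by
    have := hv (g.symm w)
    rw [ContinuousAlternatingMap.compContinuousLinearMap_apply] at this
    convert this using 2
    ext i
    fin_cases i <;> simp
  simpa using this

theorem lefschetzPow_comp {F : Type*} [NormedAddCommGroup F] [NormedSpace ℝ F] (a : Alt E 2)
    {j : ℕ} (b : Alt E j) (g : F →L[ℝ] E) (k : ℕ) :
    (lefschetzPow a j k b).compContinuousLinearMap g =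
      lefschetzPow (a.compContinuousLinearMap g) j k (b.compContinuousLinearMap g) := by
  induction k with
  | zero => rfl
  | succ k ih =>
    rw [lefschetzPow_succ, wedge_comp, ih]
    rfl

theorem contDiff_lefschetzPow (j k : ℕ) :
    ContDiff ℝ (⊤ : ℕ∞) fun a : Alt E 2 => lefschetzPow a j k := by
  induction k with
  | zero => exact contDiff_const
  | succ k ih => exact (wedge E 2 (j + 2 * k)).contDiff.clm_comp ih

variable [FiniteDimensional ℝ E]

theorem continuous_multilinearMap {k : ℕ} (f : MultilinearMap ℝ (fun _ : Fin k => E) ℝ) :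
    Continuous f := by
  let b := Module.finBasis ℝ E
  have h : ∀ v, f v = ∑ r : Fin k → Fin (Module.finrank ℝ E),
      (∏ i, b.coord (r i) (v i)) • f (fun i => b (r i)) := by
    intro v
    conv_lhs => rw [show v = fun i => ∑ j, b.coord j (v i) • b j from
      funext fun i => (b.sum_repr (v i)).symm]
    rw [f.map_sum]
    exact Finset.sum_congr rfl fun r _ => f.map_smul_univ _ _
  have hc : ∀ j, Continuous (b.coord j) := fun j => LinearMap.continuous_of_finiteDimensional _
  rw [show ⇑f = _ from funext h]
  fun_prop

/-- In finite dimension, alternating maps are automatically continuous. -/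
noncomputable def altEquiv (E : Type*) [NormedAddCommGroup E] [NormedSpace ℝ E]
    [FiniteDimensional ℝ E] (k : ℕ) : Alt E k ≃ₗ[ℝ] (E [⋀^Fin k]→ₗ[ℝ] ℝ) :=
  LinearEquiv.ofBijective ContinuousAlternatingMap.toAlternatingMapLinear
    ⟨ContinuousAlternatingMap.toAlternatingMap_injective, fun f => 
      ⟨⟨⟨f.toMultilinearMap, continuous_multilinearMap _⟩, f.map_eq_zero_of_eq'⟩, rfl⟩⟩

instance finiteDimensional_alt (k : ℕ) : FiniteDimensional ℝ (Alt E k) :=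
  Module.Finite.equiv
    ((altEquiv E k).trans exteriorPower.alternatingMapLinearEquiv).symm

theorem finrank_alt (k : ℕ) :
    Module.finrank ℝ (Alt E k) = (Module.finrank ℝ E).choose k := by
  rw [((altEquiv E k).trans exteriorPower.alternatingMapLinearEquiv).finrank_eq,
    Subspace.dual_finrank_eq, exteriorPower.finrank_eq]

theorem subsingleton_alt {k : ℕ} (hk : Module.finrank ℝ E < k) : Subsingleton (Alt E k) :=
  Module.finrank_zero_iff.mp ((finrank_alt k).trans (Nat.choose_eq_zero_of_lt hk))

/-- Source and target have the same dimension, by the symmetry of binomial coefficients, so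
injectivity suffices. -/
theorem Nondegenerate.lefschetzPow_bijective {a : Alt E 2}
    (ha : Nondegenerate a) {j k : ℕ} (hjk : 2 * (j + k) = Module.finrank ℝ E) :
    Function.Bijective (lefschetzPow a j k) := by
  have hi := ha.lefschetzPow_injective hjk.le
  refine ⟨hi, (LinearMap.injective_iff_surjective_of_finrank_eq_finrank
    (f := (lefschetzPow a j k).toLinearMap) ?_).mp hi⟩
  rw [finrank_alt, finrank_alt, ← Nat.choose_symm (by omega)]
  congr 1
  omega

theorem Nondegenerate.exists_lefschetzEquiv {a : Alt E 2}
    (ha : Nondegenerate a) {j k : ℕ} (hjk : 2 * (j + k) = Module.finrank ℝ E) :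
    ∃ g : Alt E j ≃L[ℝ] Alt E (j + 2 * k), (g : Alt E j →L[ℝ] Alt E (j + 2 * k)) =
      lefschetzPow a j k :=
  ⟨(LinearEquiv.ofBijective _ (ha.lefschetzPow_bijective hjk)).toContinuousLinearEquiv, rfl⟩

theorem Nondegenerate.contDiffAt_inverse_lefschetzPow {a : Alt E 2}
    (ha : Nondegenerate a) {j k : ℕ} (hjk : 2 * (j + k) = Module.finrank ℝ E) :
    ContDiffAt ℝ (⊤ : ℕ∞) (fun a : Alt E 2 => (lefschetzPow a j k).inverse) a := by
  obtain ⟨g, hg⟩ := ha.exists_lefschetzEquiv hjk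
  have h : ContDiffAt ℝ (⊤ : ℕ∞) ContinuousLinearMap.inverse (lefschetzPow a j k) := by
    rw [← hg]
    exact contDiffAt_map_inverse g
  exact h.comp a (contDiff_lefschetzPow j k).contDiffAt

end PointwiseLefschetz

/-! ### Lefschetz maps on differential forms and primitives in the filtration. -/

section LefschetzForms
variable {E : Type*} [NormedAddCommGroup E] [NormedSpace ℝ E]
  {M : Type*} [TopologicalSpace M] [ChartedSpace E M]

/-- The iterated Lefschetz map `α ↦ ω ∧ ⋯ ∧ ω ∧ α` on differential forms. -/
noncomputable def lefschetzPowForm (ω : Form E M 2) (j : ℕ) :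
    (k : ℕ) → Form E M j →ₗ[ℝ] Form E M (j + 2 * k)
  | 0 => LinearMap.id
  | k + 1 => (wedgeForm 2 (j + 2 * k) ω).comp (lefschetzPowForm ω j k)

theorem lefschetzPowForm_apply (ω : Form E M 2) {j : ℕ} (k : ℕ) (α : Form E M j) (x : M) :
    (lefschetzPowForm ω j k α).1 x = lefschetzPow (E := E) (ω.1 x) j k (α.1 x) := by
  induction k with
  | zero => rfl
  | succ k ih => exact congrArg (wedge E 2 (j + 2 * k) (ω.1 x)) ih

theorem lefschetzFil_add_two_mul (ω : Form E M 2) (j p : ℕ) :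
    lefschetzFil ω p (j + 2 * p) = LinearMap.range (lefschetzPowForm ω j p) := by
  induction p with
  | zero => exact LinearMap.range_id.symm
  | succ p ih =>
    refine (congrArg (Submodule.map (wedgeForm 2 (j + 2 * p) ω)) ih).trans ?_
    exact (LinearMap.range_comp _ _).symm

theorem lefschetzFil_eq_bot (ω : Form E M 2) {p m : ℕ} (h : m < 2 * p) :
    lefschetzFil ω p m = ⊥ := by
  induction p generalizing m with
  | zero => omega
  | succ p ih =>
    match m with
    | 0 => rfl
    | 1 => rfl
    | m + 2 =>
      refine (congrArg (Submodule.map (wedgeForm 2 m ω)) (ih (by omega))).trans ?_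
      exact Submodule.map_bot _

theorem subsingleton_form [FiniteDimensional ℝ E] {m : ℕ} (hm : Module.finrank ℝ E < m) : Subsingleton (Form E M m) :=
  ⟨fun α β => Subtype.ext (funext fun x => (subsingleton_alt (E := E) hm).elim (α.1 x) (β.1 x))⟩

/-- Polarization of `η ∧ η ∧ α = 0`. -/
theorem wedgeForm_one_comm {m : ℕ} (η τ : Form E M 1) (α : Form E M m) :
    wedgeForm 1 (m + 1) η (wedgeForm 1 m τ α) = - wedgeForm 1 (m + 1) τ (wedgeForm 1 m η α) := by
  have h0 : ∀ η : Form E M 1, wedgeForm 1 (m + 1) η (wedgeForm 1 m η α) = 0 := fun η =>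
    Subtype.ext (funext fun x => wedge_one_self (E := E) (η.1 x) (α.1 x))
  have h := h0 (η + τ)
  simp only [map_add, LinearMap.add_apply, h0, zero_add, add_zero] at h
  exact eq_neg_of_add_eq_zero_right h

variable [IsManifold 𝓘(ℝ, E) (⊤ : ℕ∞) M] {ω : Form E M 2} {θ : Form E M 1}

theorem IsLCS.nondegenerate_apply (h : IsLCS ω θ) (x : M) : Nondegenerate (E := E) (ω.1 x) :=
  h.nondegenerate x

theorem IsLCS.nondegenerate_chartRep (h : IsLCS ω θ) (x₀ : M) {y : E}
    (hy : y ∈ (chartAt E x₀).target) : Nondegenerate (chartRep ω.1 x₀ y) :=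
  (h.nondegenerate_apply _).comp (F := E)
    ((mdifferentiable_chart (I := 𝓘(ℝ, E)) (M := M) x₀).symm.mfderiv hy)

/-- Leibniz gives `d_k (τ ∧ α) = dτ ∧ α - τ ∧ dα + k θ ∧ τ ∧ α`. Substituting `dα = -(k - 1) θ ∧ α`
leaves exactly one copy of `θ ∧ τ ∧ α`, which completes `dτ` to `d_1 τ`. -/
theorem wedgeForm_lichD {τ : Form E M 1} (hτ : ω = lichD θ 1 1 τ) (k : ℤ) {m : ℕ}
    (α : Form E M m) (hα : lichD θ (k - 1) m α = 0) :
    wedgeForm 2 m ω α = lichD θ k (m + 1) (wedgeForm 1 m τ α) := by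
  have h1 : wedgeForm 2 m (wedgeForm 1 1 θ τ) α = wedgeForm 1 (m + 1) θ (wedgeForm 1 m τ α) :=
    Subtype.ext (funext fun x => wedge_one_wedge (E := E) (θ.1 x) (τ.1 x) (α.1 x))
  have h2 : extD m α = -(((k - 1 : ℤ) : ℝ) • wedgeForm 1 m θ α) := eq_neg_of_add_eq_zero_left hα
  rw [hτ, lichD_apply, lichD_apply, extD_wedge_one, h2, map_neg, map_smul,
    wedgeForm_one_comm τ θ α, map_add, LinearMap.add_apply, map_smul, LinearMap.smul_apply, h1]
  push_cast
  module

variable [FiniteDimensional ℝ E]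

theorem IsLCS.lefschetzPowForm_injective (h : IsLCS ω θ) {j k : ℕ}
    (hjk : 2 * (j + k) ≤ Module.finrank ℝ E) :
    Function.Injective (lefschetzPowForm ω j k) := by
  intro α β hαβ
  refine Subtype.ext (funext fun x => (h.nondegenerate_apply x).lefschetzPow_injective hjk ?_)
  rw [← lefschetzPowForm_apply, ← lefschetzPowForm_apply, hαβ]

theorem IsLCS.lefschetzPowForm_surjective (h : IsLCS ω θ) {j k : ℕ}
    (hjk : 2 * (j + k) = Module.finrank ℝ E) :
    Function.Surjective (lefschetzPowForm ω j k) := by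
  intro α
  have hinv : ∀ {a : Alt E 2}, Nondegenerate a → ∀ {b : Alt E j} {c : Alt E (j + 2 * k)},
      lefschetzPow a j k b = c → b = (lefschetzPow a j k).inverse c := by
    rintro a ha b c rfl
    obtain ⟨g, hg⟩ := ha.exists_lefschetzEquiv hjk
    rw [← hg, ContinuousLinearMap.inverse_equiv]
    simp
  -- The pointwise preimage is unique, so in a chart it is the inverse of `L^k` applied to `α`; it
  -- is smooth because inversion is smooth at invertible operators.
  choose β hβ using fun x => ((h.nondegenerate_apply x).lefschetzPow_bijective hjk).2 (α.1 x)
  refine ⟨⟨β, fun x₀ => ?_⟩, Subtype.ext (funext fun x => ?_)⟩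
  · have hrep : ∀ y ∈ (chartAt E x₀).target, chartRep β x₀ y =
        (lefschetzPow (chartRep ω.1 x₀ y) j k).inverse (chartRep α.1 x₀ y) := by
      intro y hy
      refine hinv (h.nondegenerate_chartRep x₀ hy) ?_
      refine (lefschetzPow_comp (E := E) (F := E) _ _ _ k).symm.trans ?_
      rw [hβ]
      rfl
    refine ContDiffOn.congr (fun y hy => ?_) hrep
    have h1 := (h.nondegenerate_chartRep x₀ hy).contDiffAt_inverse_lefschetzPow hjk
    exact (h1.comp_contDiffWithinAt y (ω.2 x₀ y hy)).clm_apply (α.2 x₀ y hy)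
  · rw [lefschetzPowForm_apply]
    exact hβ x

/-- In degree `n + k` with `p ≤ k ≤ n`, surjectivity of `L^k` makes already `F^k` everything, and
`F^k ⊆ F^p`. Above degree `2n` there are no nonzero forms. -/
theorem IsLCS.lefschetzFil_eq_top (h : IsLCS ω θ) {n : ℕ} (hn : Module.finrank ℝ E = 2 * n)
    {p m : ℕ} (hpm : n + p ≤ m) : lefschetzFil ω p m = ⊤ := by
  rcases Nat.lt_or_ge (2 * n) m with hm | hm
  · have := subsingleton_form (E := E) (M := M) (hn.trans_lt hm)
    exact Subsingleton.elim _ _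
  · obtain ⟨k, rfl⟩ := Nat.exists_eq_add_of_le (show n ≤ m by omega)
    obtain ⟨j, rfl⟩ := Nat.exists_eq_add_of_le' (show k ≤ n by omega)
    have h1 : lefschetzFil ω k (j + k + k) = ⊤ := by
      rw [add_assoc, ← two_mul, lefschetzFil_add_two_mul, LinearMap.range_eq_top]
      exact h.lefschetzPowForm_surjective hn.symm
    rw [eq_top_iff, ← h1]
    exact antitone_nat_of_succ_le (f := fun p => lefschetzFil ω p (j + k + k))
      (fun p => lefschetzFil_succ_le ω p _) (by omega)

/-- Writing `α = L^p β` with `β` of degree `m - 2p`, the hypothesis is `L^{p+1} β = 0`, and `(m -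
2p) + (p + 1) ≤ n` is the range of injectivity. -/
theorem IsLCS.eq_zero_of_wedgeForm_eq_zero (h : IsLCS ω θ) {n : ℕ}
    (hn : Module.finrank ℝ E = 2 * n) {p m : ℕ} (hpm : m + 1 ≤ n + p) {α : Form E M m}
    (hα : α ∈ lefschetzFil ω p m) (h0 : wedgeForm 2 m ω α = 0) : α = 0 := by
  rcases Nat.lt_or_ge m (2 * p) with hm | hm
  · rw [lefschetzFil_eq_bot ω hm] at hα
    exact hα
  · obtain ⟨j, rfl⟩ := Nat.exists_eq_add_of_le' hm
    rw [lefschetzFil_add_two_mul] at hα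
    obtain ⟨β, rfl⟩ := hα
    have hβ : β = 0 := h.lefschetzPowForm_injective (k := p + 1) (by omega) (by
      rw [map_zero]; exact h0)
    rw [hβ, map_zero]

/-- If `α = ω ∧ β`, then `ω ∧ d_{k-1} β = 0`, hence `d_{k-1} β = 0`. For `p = 0` the primitive is `τ
∧ β`; otherwise `β = d_{k-1} γ` by induction, and `ω ∧ γ` is a primitive of `α`. The weight `k`
drops at each step, so it must vary in the induction. -/
theorem IsLCS.exists_lichD_eq (h : IsLCS ω θ) {n : ℕ} (hn : Module.finrank ℝ E = 2 * n)
    {τ : Form E M 1} (hτ : ω = lichD θ 1 1 τ) {p m : ℕ} (k : ℤ) (hpm : m + 1 ≤ n + p)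
    {α : Form E M (m + 1)} (hα : α ∈ lefschetzFil ω (p + 1) (m + 1))
    (h0 : lichD θ k (m + 1) α = 0) : ∃ β ∈ lefschetzFil ω p m, lichD θ k m β = α := by
  induction p generalizing m k with
  | zero =>
    match m with
    | 0 => exact ⟨0, Submodule.zero_mem _, by rw [map_zero]; exact (show α = 0 from hα).symm⟩
    | m + 1 =>
      obtain ⟨β, -, rfl⟩ := hα
      rw [lichD_lefschetz h] at h0
      have := h.eq_zero_of_wedgeForm_eq_zero hn (p := 0) (by omega) Submodule.mem_top h0
      exact ⟨_, Submodule.mem_top, (wedgeForm_lichD hτ k β this).symm⟩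
  | succ p ih =>
    match m with
    | 0 => exact ⟨0, Submodule.zero_mem _, by rw [map_zero]; exact (show α = 0 from hα).symm⟩
    -- Here `β` is a function lying in `F^{p+1}`, hence zero.
    | 1 =>
      obtain ⟨β, hβ, rfl⟩ := hα
      refine ⟨0, Submodule.zero_mem _, ?_⟩
      rw [show β = 0 from hβ, map_zero, map_zero]
    | m + 2 =>
      obtain ⟨β, hβ, rfl⟩ := hα
      have h1 := (lichD_lefschetz h k β).symm.trans h0
      have h2 := h.eq_zero_of_wedgeForm_eq_zero hn (p := p + 1) (by omega)
        (lichD_mem_lefschetzFil h (k - 1) (p + 1) hβ) h1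
      obtain ⟨γ, hγ, rfl⟩ := ih (k - 1) (by omega) hβ h2
      exact ⟨wedgeForm 2 m ω γ, ⟨γ, hγ, rfl⟩, lichD_lefschetz h k γ⟩

end LefschetzForms

/-! ### Degeneration criteria for a general filtered complex. -/

section SpectralSequence
universe u v

namespace FilteredComplex
variable {R : Type u} [Ring R] {K : ℕ → Type v} [∀ m, AddCommGroup (K m)] [∀ m, Module R (K m)]
  {C : FilteredComplex R K}

theorem d_eq_zero_of_mem_coboundaries {m : ℕ} {x : K m} (hx : x ∈ C.coboundaries m) :
    C.d m x = 0 := by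
  cases m with
  | zero => rw [show x = 0 from hx, map_zero]
  | succ m =>
    obtain ⟨y, rfl⟩ := hx
    exact C.d_d m y

theorem B_le_coboundaries (r p : ℤ) (m : ℕ) : C.B r p m ≤ C.coboundaries m := by
  cases m with
  | zero => exact le_rfl
  | succ m =>
    rintro _ ⟨-, y, -, rfl⟩
    exact ⟨y, rfl⟩

theorem B_mono {r s : ℤ} (hrs : r ≤ s) (p : ℤ) (m : ℕ) : C.B r p m ≤ C.B s p m := by
  cases m with
  | zero => exact le_rfl
  | succ m => exact inf_le_inf_left _ (Submodule.map_mono (C.F_anti (by omega) m))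

theorem mem_Z_of_d_eq_zero {r p : ℤ} {m : ℕ} {x : K m} (hx : x ∈ C.F p m) (h : C.d m x = 0) :
    x ∈ C.Z r p m :=
  ⟨hx, by rw [SetLike.mem_coe, Submodule.mem_comap, h]; exact Submodule.zero_mem _⟩

/-- If every `x ∈ F^p` with `d x ∈ F^{p+s}` is congruent to a cocycle in `F^p` modulo `F^{p+1}`, then the
spectral sequence stabilizes at `E_s`. -/
theorem stabilizesAt_of_exists_cocycle {s : ℤ}
    (h : ∀ (p : ℤ) (m : ℕ), ∀ x ∈ C.Z s p m,
      ∃ y ∈ C.F p m, C.d m y = 0 ∧ x - y ∈ C.F (p + 1) m) :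
    C.StabilizesAt s := by
  -- Since `d(x - y) = d x`, the correction lies in `Z_{r-1}^{p+1}`, one of the two summands of the
  -- denominator of `E_r`.
  have hZ : ∀ r, s ≤ r → ∀ (p : ℤ) (m : ℕ), ∀ x ∈ C.Z r p m,
      ∃ y ∈ C.F p m, C.d m y = 0 ∧ x - y ∈ C.Z (r - 1) (p + 1) m := by
    intro r hr p m x hx
    obtain ⟨y, hy, hy0, hxy⟩ := h p m x ⟨hx.1, C.F_anti (by omega) _ hx.2⟩
    refine ⟨y, hy, hy0, hxy, ?_⟩
    rw [SetLike.mem_coe, Submodule.mem_comap, map_sub, hy0, sub_zero,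
      show p + 1 + (r - 1) = p + r by ring]
    exact hx.2
  -- A boundary `d x` with `x ∈ F^{p-r}` equals `d(x - y)` with `x - y ∈ F^{p-r+1}`, so `B_r ⊆
  -- B_{r-1}`. The same replacement makes `d_r` vanish below.
  have hB : ∀ r, s ≤ r → ∀ (p : ℤ) (m : ℕ), C.B r p m ≤ C.denom r p m := by
    intro r hr p m
    cases m with
    | zero => exact (bot_le : (⊥ : Submodule R (K 0)) ≤ _)
    | succ m =>
      rintro _ ⟨hp, x, hx, rfl⟩
      obtain ⟨y, -, hy0, hxy⟩ := hZ r hr (p - r) m x ⟨hx, by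
        rw [SetLike.mem_coe, Submodule.mem_comap, sub_add_cancel]; exact hp⟩
      refine Submodule.mem_sup_right ⟨hp, x - y, ?_, by rw [map_sub, hy0, sub_zero]⟩
      rw [show p - (r - 1) = p - r + 1 by ring]
      exact hxy.1
  intro r hr p m
  constructor
  · refine LinearMap.ext fun a => ?_
    obtain ⟨⟨x, hx⟩, rfl⟩ := Submodule.Quotient.mk_surjective _ a
    refine (Submodule.Quotient.mk_eq_zero _).mpr ?_
    change C.d m x ∈ C.denom r (p + r) (m + 1)
    obtain ⟨y, -, hy0, hxy⟩ := hZ r hr p m x hx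
    refine Submodule.mem_sup_right ⟨hx.2, x - y, ?_, by rw [map_sub, hy0, sub_zero]⟩
    rw [show p + r - (r - 1) = p + 1 by ring]
    exact hxy.1
  · have hle : C.denom (r + 1) p m ≤ C.denom r p m := by
      refine sup_le ?_ ?_
      · rw [show r + 1 - 1 = r - 1 + 1 by ring]
        exact (C.Z_le _ _ _).trans le_sup_left
      · rw [add_sub_cancel_right]
        exact hB r hr p m
    let g : C.page (r + 1) p m →ₗ[R] C.page r p m :=
      Submodule.mapQ _ _ (Submodule.inclusion (C.Z_le r p m)) fun x hx => hle hx
    refine ⟨LinearEquiv.ofBijective g ⟨?_, ?_⟩, fun x hx => rfl⟩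
    · rw [injective_iff_map_eq_zero]
      intro a ha
      obtain ⟨⟨x, hx⟩, rfl⟩ := Submodule.Quotient.mk_surjective _ a
      have hx' : x ∈ C.denom r p m := (Submodule.Quotient.mk_eq_zero ((C.denom r p m).submoduleOf (C.Z r p m))).mp ha
      refine (Submodule.Quotient.mk_eq_zero _).mpr ?_
      change x ∈ C.denom (r + 1) p m
      obtain ⟨z, hz, b, hb, rfl⟩ := Submodule.mem_sup.mp hx'
      -- As `b` is closed, `d z = d x ∈ F^{p+r+1}`, which promotes `z` from `Z_{r-1}^{p+1}` to
      -- `Z_r^{p+1}`.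
      refine Submodule.add_mem_sup ⟨hz.1, ?_⟩ (B_mono (by omega) _ _ hb)
      have hxd := hx.2
      rw [SetLike.mem_coe, Submodule.mem_comap, map_add,
        d_eq_zero_of_mem_coboundaries (B_le_coboundaries _ _ _ hb), add_zero] at hxd
      rw [SetLike.mem_coe, Submodule.mem_comap, show p + 1 + (r + 1 - 1) = p + (r + 1) by ring]
      exact hxd
    · intro a
      obtain ⟨⟨x, hx⟩, rfl⟩ := Submodule.Quotient.mk_surjective _ a
      obtain ⟨y, hy, hy0, hxy⟩ := hZ r hr p m x hx
      refine ⟨C.classPage y (mem_Z_of_d_eq_zero hy hy0), Eq.symm ?_⟩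
      refine (Submodule.Quotient.eq _).mpr ?_
      exact Submodule.mem_sup_left hxy

/-- A criterion for `E_r^{p,q}` to be canonically isomorphic to the cohomology of the complex. -/
theorem isoToCohomology_of {r p : ℤ} {m : ℕ} (hF : ∀ x, C.d m x = 0 → x ∈ C.F p m)
    (hB : C.coboundaries m ≤ C.denom r p m)
    (hZ : ∀ x ∈ C.Z (r - 1) (p + 1) m, C.d m x = 0 → x ∈ C.coboundaries m)
    (h : ∀ x ∈ C.Z r p m, ∃ y, C.d m y = 0 ∧ x - y ∈ C.Z (r - 1) (p + 1) m) :
    C.IsoToCohomology r p m := by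
  have hle : C.cocycles m ≤ C.Z r p m := fun x hx => mem_Z_of_d_eq_zero (hF x hx) hx
  let g : C.H m →ₗ[R] C.page r p m :=
    Submodule.mapQ _ _ (Submodule.inclusion hle) fun x hx => hB hx
  refine ⟨LinearEquiv.ofBijective g ⟨?_, ?_⟩, fun x hx => ⟨hle hx, rfl⟩⟩
  · rw [injective_iff_map_eq_zero]
    intro a ha
    obtain ⟨⟨x, hx⟩, rfl⟩ := Submodule.Quotient.mk_surjective _ a
    have hx' : x ∈ C.denom r p m := (Submodule.Quotient.mk_eq_zero ((C.denom r p m).submoduleOf (C.Z r p m))).mp ha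
    refine (Submodule.Quotient.mk_eq_zero _).mpr ?_
    change x ∈ C.coboundaries m
    obtain ⟨z, hz, b, hb, rfl⟩ := Submodule.mem_sup.mp hx'
    have hb' := B_le_coboundaries _ _ _ hb
    have hx0 : C.d m (z + b) = 0 := hx
    rw [map_add, d_eq_zero_of_mem_coboundaries hb', add_zero] at hx0
    exact add_mem (hZ z hz hx0) hb'
  · intro a
    obtain ⟨⟨x, hx⟩, rfl⟩ := Submodule.Quotient.mk_surjective _ a
    obtain ⟨y, hy0, hxy⟩ := h x hx
    refine ⟨C.classH y hy0, Eq.symm ?_⟩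
    refine (Submodule.Quotient.eq _).mpr ?_
    exact Submodule.mem_sup_left hxy

theorem sub_mem_Z {p : ℤ} {m : ℕ} {x y : K m} (hx : x ∈ C.Z 2 p m) (hy : C.d m y = 0)
    (hxy : x - y ∈ C.F (p + 1) m) : x - y ∈ C.Z (2 - 1) (p + 1) m := by
  refine ⟨hxy, ?_⟩
  rw [SetLike.mem_coe, Submodule.mem_comap, map_sub, hy, sub_zero,
    show p + 1 + (2 - 1) = p + 2 by ring]
  exact hx.2

end FilteredComplex

/-! ### Cocycle representatives in the filtered complex of the structure. -/

variable {E : Type*} [NormedAddCommGroup E] [NormedSpace ℝ E]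
  {M : Type*} [TopologicalSpace M] [ChartedSpace E M] [IsManifold 𝓘(ℝ, E) (⊤ : ℕ∞) M]
  {ω : Form E M 2} {θ τ : Form E M 1}

theorem lcsComplex_F_of_nonpos (h : IsLCS ω θ) (l : ℤ) {p : ℤ} (hp : p ≤ 0) (m : ℕ) :
    (lcsComplex h l).F p m = ⊤ := by
  change lefschetzFil ω p.toNat m = ⊤
  rw [Int.toNat_of_nonpos hp]
  rfl

variable [FiniteDimensional ℝ E]

/-- For `p < 0` or `m > n + p`, `F^{p+1}` is everything and `y = 0` works. Otherwise `d x` is a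
closed form in `F^{p+2}` of degree at most `n + p + 1`, so it has a primitive in `F^{p+1}`, which is
subtracted from `x`. -/
theorem IsLCS.exists_cocycle (h : IsLCS ω θ) {n : ℕ} (hn : Module.finrank ℝ E = 2 * n)
    (hτ : ω = lichD θ 1 1 τ) (l p : ℤ) (m : ℕ) (x : Form E M m)
    (hx : x ∈ (lcsComplex h l).Z 2 p m) :
    ∃ y ∈ (lcsComplex h l).F p m, (lcsComplex h l).d m y = 0 ∧
      x - y ∈ (lcsComplex h l).F (p + 1) m := by
  rcases lt_or_ge p 0 with hp | hp
  · refine ⟨0, Submodule.zero_mem _, map_zero _, ?_⟩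
    rw [lcsComplex_F_of_nonpos h l (by omega)]
    exact Submodule.mem_top
  · obtain ⟨p, rfl⟩ := Int.eq_ofNat_of_zero_le hp
    rcases Nat.lt_or_ge (n + p) m with hm | hm
    · refine ⟨0, Submodule.zero_mem _, map_zero _, ?_⟩
      change x - 0 ∈ lefschetzFil ω (p + 1) m
      rw [h.lefschetzFil_eq_top hn (by omega)]
      exact Submodule.mem_top
    · obtain ⟨y, hy, hyx⟩ := h.exists_lichD_eq hn hτ (p := p + 1) l (by omega)
        (show lichD θ l m x ∈ lefschetzFil ω (p + 2) (m + 1) from hx.2)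
        (lichD_lichD h.extD_theta l x)
      refine ⟨x - y, sub_mem hx.1 (lefschetzFil_succ_le ω p m hy), ?_, ?_⟩
      · change lichD θ l m (x - y) = 0
        rw [map_sub, hyx, sub_self]
      · rw [sub_sub_cancel]
        exact hy

/-- The primitive lies only one filtration step lower, so the form is in `B_1`, the boundary part of
the denominator of `E_2`. -/
theorem IsLCS.mem_coboundaries (h : IsLCS ω θ) {n : ℕ} (hn : Module.finrank ℝ E = 2 * n)
    (hτ : ω = lichD θ 1 1 τ) (l : ℤ) {p m : ℕ} (hm : m ≤ n + p) {x : Form E M m}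
    (hx : x ∈ lefschetzFil ω (p + 1) m) (hx0 : lichD θ l m x = 0) :
    x ∈ (lcsComplex h l).B 1 (p + 1 : ℕ) m := by
  cases m with
  | zero => exact hx
  | succ m =>
    obtain ⟨y, hy, hyx⟩ := h.exists_lichD_eq hn hτ l hm hx hx0
    refine ⟨hx, y, ?_, hyx⟩
    rw [show ((p + 1 : ℕ) : ℤ) - 1 = p by push_cast; ring]
    exact hy

end SpectralSequence
end LCS

/-! ### The four assertions. -/

theorem theorem5p2 {E : Type*} [NormedAddCommGroup E] [NormedSpace ℝ E] [FiniteDimensional ℝ E]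
    {M : Type*} [TopologicalSpace M] [ChartedSpace E M] [IsManifold 𝓘(ℝ, E) (⊤ : ℕ∞) M]
    (n : ℕ) (hn : Module.finrank ℝ E = 2 * n)
    (ω : LCS.Form E M 2) (θ : LCS.Form E M 1) (h : LCS.IsLCS ω θ)
    (τ : LCS.Form E M 1) (hτ : ω = LCS.lichD θ 1 1 τ) (l : ℤ) :
    (∀ p q : ℕ, 1 ≤ p → p ≤ q → q + 1 ≤ n →
      Subsingleton ((LCS.lcsComplex h l).page 2 p (p + q))) ∧
    (∀ q : ℕ, q ≤ n → (LCS.lcsComplex h l).IsoToCohomology 2 0 q) ∧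
    (∀ p : ℕ, p ≤ n → (LCS.lcsComplex h (l + p)).IsoToCohomology 2 p (p + n)) ∧
    (LCS.lcsComplex h l).StabilizesAt 2 := by
  refine ⟨fun p q hp _ hq => ?_, fun q hq => ?_, fun p _ => ?_,
    LCS.FilteredComplex.stabilizesAt_of_exists_cocycle
      (h.exists_cocycle hn hτ l)⟩
  · refine subsingleton_of_forall_eq 0 fun a => ?_
    obtain ⟨⟨x, hx⟩, rfl⟩ := Submodule.Quotient.mk_surjective _ a
    refine (Submodule.Quotient.mk_eq_zero _).mpr ?_
    change x ∈ (LCS.lcsComplex h l).denom 2 p (p + q)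
    obtain ⟨y, hy, hy0, hxy⟩ := h.exists_cocycle hn hτ l p _ x hx
    obtain ⟨p, rfl⟩ := Nat.exists_eq_add_of_le' hp
    rw [← sub_add_cancel x y]
    -- The cocycle `y ∈ F^p` has degree `p + q ≤ n + (p - 1)`, so it is in `B_1`; this is where `p ≥
    -- 1` and `q ≤ n - 1` enter.
    exact Submodule.add_mem_sup (LCS.FilteredComplex.sub_mem_Z hx hy0 hxy)
      (h.mem_coboundaries hn hτ l (by omega) hy hy0)
  · refine LCS.FilteredComplex.isoToCohomology_of (fun x _ => Submodule.mem_top) ?_ ?_ ?_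
    · refine le_trans ?_ le_sup_right
      cases q with
      | zero => exact le_rfl
      | succ q =>
        rintro _ ⟨y, rfl⟩
        -- Both `F^0` and `F^{-1}` are everything, so `B_1^{0,q}` consists of all coboundaries.
        exact ⟨Submodule.mem_top, y, Submodule.mem_top, rfl⟩
    · intro x hx hx0
      exact LCS.FilteredComplex.B_le_coboundaries _ _ _
        (h.mem_coboundaries hn hτ l (p := 0) hq hx.1 hx0)
    · intro x hx
      obtain ⟨y, -, hy0, hxy⟩ := h.exists_cocycle hn hτ l 0 _ x hx
      exact ⟨y, hy0, LCS.FilteredComplex.sub_mem_Z hx hy0 hxy⟩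
  · have htop : (LCS.lcsComplex h (l + p)).F p (p + n) = ⊤ :=
      h.lefschetzFil_eq_top hn (Nat.add_comm n p).le
    refine LCS.FilteredComplex.isoToCohomology_of (fun x _ => by rw [htop]; trivial) ?_ ?_ ?_
    · refine le_trans ?_ le_sup_right
      -- In degree `n + p - 1` the step `F^{p-1}` is everything, for `p = 0` by the convention on
      -- negative indices. Thus `B_1` again contains all coboundaries.
      have htop' : ∀ m, m + 1 = p + n → (LCS.lcsComplex h (l + p)).F (p - (2 - 1)) m = ⊤ := by
        intro m hm
        cases p with
        | zero => exact LCS.lcsComplex_F_of_nonpos h _ (by norm_num) m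
        | succ p =>
          rw [show ((p + 1 : ℕ) : ℤ) - (2 - 1) = p by push_cast; ring]
          exact h.lefschetzFil_eq_top hn (by omega)
      -- `B` and the coboundaries are defined by cases on the degree, so `p + n` has to become a
      -- variable.
      generalize p + n = m at *
      cases m with
      | zero => exact le_rfl
      | succ m =>
        rintro _ ⟨y, rfl⟩
        refine ⟨by rw [htop]; trivial, y, ?_, rfl⟩
        rw [htop' m rfl]
        trivial
    · intro x hx hx0
      exact LCS.FilteredComplex.B_le_coboundaries _ _ _
        (h.mem_coboundaries hn hτ _ (p := p) (Nat.add_comm p n).le hx.1 hx0)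
    · intro x hx
      obtain ⟨y, -, hy0, hxy⟩ := h.exists_cocycle hn hτ _ p _ x hx
      exact ⟨y, hy0, LCS.FilteredComplex.sub_mem_Z hx hy0 hxy⟩
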